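/- Let $\mathbb D=\{z\in\mathbb C:|z|<1\}$ and let $\mathbf h^2$ be the space of complex-valued harmonic functions $f$ on $\mathbb D$ for which $\frac1{2\pi}\int_0^{2\pi}|f(re^{i\theta})|^2\,d\theta$ is bounded uniformly in $0\le r<1$. Write $f=h+\overline g$ with $h,g$ analytic in $\mathbb D$ and $g(0)=0$. For a function $F$ on $\mathbb D$ let $F(e^{i\theta})=\lim_{r\to1^-}F(re^{i\theta})$ denote its radial limit, and put $$\|hg\|_1=\int_0^{2\pi}|h(e^{i\theta})g(e^{i\theta})|\,d\theta ,$$ where $h(e^{i\theta})g(e^{i\theta})$ is the radial limit of the product $hg$. If $f=h+\overline g\in\mathbf h^2$, then the radial limits of $f$ and of $hg$ exist for almost every $\theta$, all integrals below converge, and for all $t\in\mathbb R$ $$\int_{-1}^{1}|f(xe^{it})|^2\,dx\;\le\;\frac12\int_0^{2\pi}|f(e^{i\theta})|^2\,d\theta+\|hg\|_1\;\le\;\int_0^{2\pi}|f(e^{i\theta})|^2\,d\theta .$$ Both inequalities are sharp: for every $t\in\mathbb R$ and every $C<1$ there is $f=h+\overline g\in\mathbf h^2$ (with $g(0)=0$)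 such that simultaneously $$\int_{-1}^{1}|f(xe^{it})|^2\,dx> C\Bigl(\frac12\int_0^{2\pi}|f(e^{i\theta})|^2\,d\theta+\|hg\|_1\Bigr)\quad\text{and}\quad \frac12\int_0^{2\pi}|f(e^{i\theta})|^2\,d\theta+\|hg\|_1> C\int_0^{2\pi}|f(e^{i\theta})|^2\,d\theta .$$ -/

import Mathlib

open MeasureTheory Filter Topology

noncomputable section

/-- The integral mean `M_p(r, f) = ((1/2π) ∫_0^{2π} |f(r e^{iθ})|^p dθ)^{1/p}`. -/
def integralMean (p r : ℝ) (f : ℂ → ℂ) : ℝ :=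
  ((1 / (2 * Real.pi)) *
    ∫ θ in (0 : ℝ)..(2 * Real.pi), ‖f ((r : ℂ) * Complex.exp ((θ : ℂ) * Complex.I))‖ ^ p) ^ (1 / p)

/-- The harmonic Hardy space `h^p`: complex-valued harmonic functions on the open unit disk whose
integral means `M_p(r, f)`, `0 ≤ r < 1`, are uniformly bounded. Values of `f` outside of the disk
are irrelevant. -/
structure MemHarmonicHardy (p : ℝ) (f : ℂ → ℂ) : Prop where
  harmonic : InnerProductSpace.HarmonicOnNhd f (Metric.ball (0 : ℂ) 1)
  bounded : ∃ M : ℝ, ∀ r : ℝ, 0 ≤ r → r < 1 → integralMean p r f ≤ M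

/-- The decomposition `f = h + conj g` in the unit disk, with `h`, `g` analytic there, normalized
by `g(0) = 0`. -/
structure IsCanonicalDecomposition (f h g : ℂ → ℂ) : Prop where
  analytic_h : DifferentiableOn ℂ h (Metric.ball (0 : ℂ) 1)
  analytic_g : DifferentiableOn ℂ g (Metric.ball (0 : ℂ) 1)
  normalized : g 0 = 0
  eq_on_disk : ∀ z ∈ Metric.ball (0 : ℂ) 1, f z = h z + (starRingEnd ℂ) (g z)

/-- `F` has the radial limit `w` at the boundary point `e^{iθ}`. -/
def HasRadialLimit (F : ℂ → ℂ) (θ : ℝ) (w : ℂ) : Prop :=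
  Tendsto (fun r : ℝ => F ((r : ℂ) * Complex.exp ((θ : ℂ) * Complex.I))) (𝓝[<] (1 : ℝ)) (𝓝 w)

/-- The boundary value `F(e^{iθ})`, that is, the radial limit of `F` at `e^{iθ}` (a meaningless
default value if that limit does not exist). -/
def boundaryValue (F : ℂ → ℂ) (θ : ℝ) : ℂ :=
  limUnder (𝓝[<] (1 : ℝ)) (fun r : ℝ => F ((r : ℂ) * Complex.exp ((θ : ℂ) * Complex.I)))

/-- `∫_{-1}^{1} |f(x e^{it})|² dx`. -/
def diameterIntegral (f : ℂ → ℂ) (t : ℝ) : ℝ :=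
  ∫ x in (-1 : ℝ)..1, ‖f ((x : ℂ) * Complex.exp ((t : ℂ) * Complex.I))‖ ^ 2

/-- `∫_0^{2π} |f(e^{iθ})|² dθ`. -/
def boundarySqIntegral (f : ℂ → ℂ) : ℝ :=
  ∫ θ in (0 : ℝ)..(2 * Real.pi), ‖boundaryValue f θ‖ ^ 2

/-- `∫_0^{2π} |h(e^{iθ}) g(e^{iθ})| dθ`: the unnormalized `L¹` norm of the boundary function
of `h g`. -/
def prodL1Norm (h g : ℂ → ℂ) : ℝ :=
  ∫ θ in (0 : ℝ)..(2 * Real.pi), ‖boundaryValue (fun z => h z * g z) θ‖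

end

/-! ### Fejér–Riesz inequalities on the unit disk, exponents two and one. -/

section FejerRiesz

open Complex Metric

/-! Pointwise `|h + conj g|² = |h|² + |g|² + 2 Re(hg)`, and the cross term is the real part of an
analytic function vanishing at `0`. On circles it therefore integrates to zero, so the mean square
of `f` is the sum of those of `h` and `g`. On a diameter it is at most `2|hg|`. The Fejér–Riesz
inequality `∫_{-1}^1 |F|^p ≤ (1/2) ∫_0^{2π} |F|^p`, with `p = 2` for `h` and `g` and `p = 1` for
`hg`, then gives the first inequality on smaller disks. The second is `2|hg| ≤ |h|² + |g|²` on the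
circle.

For `p = 2`, Fejér–Riesz is Cauchy's theorem for `S(z) conj(S(conj z))` on a half disk
(`integral_norm_sq_diameter_le`). For `p = 1`, a polynomial `P` is dominated by `|S|²` with equality
on the circle: zeros in the closed disk are reflected, after which each factor has a square root
(`exists_isSqrtMajorant_polynomial`). Taylor polynomials give the general case.

To reach the boundary, the orthogonality above bounds the dilations of `h` and `g` separately in
`L²`, so they converge there as `r → 1` (`Orthonormal.exists_tendsto_abel`). Poisson's formula
passes to the limit, and Lebesgue differentiation turns the `L²` limits into radial limits almost
everywhere (`ae_hasRadialLimit`). All terms of the estimate are continuous in `L²`.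

For sharpness take `h = (R - cz)^{-1/2}` and `g = cz h` with `|c| = 1` and `R = 1 + δ`. On the
circle `|h| = |g|`, so the second inequality is an equality. With `c = e^{-it}` the functions `h`
and `cz` are real on the diameter, and both sides of the first inequality are `4 log(1/δ) + O(1)`.
-/

theorem integral_diameter_eq_integral_semicircle {K : ℂ → ℂ} {R : ℝ} (hR : 1 < R)
    (hK : DifferentiableOn ℂ K (ball 0 R)) :
    ∫ x in (-1 : ℝ)..1, K x
      = -∫ θ in (0 : ℝ)..Real.pi, K (exp (θ * I)) * (exp (θ * I) * I) := by
  -- A primitive exists on the disk, so both integrals reduce to its values at the common endpoints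
  -- `1` and `-1`.
  obtain ⟨Φ, hΦ⟩ := hK.isExactOn_ball
  have hmem : ∀ θ : ℝ, exp (θ * I) ∈ ball (0 : ℂ) R := fun θ => by
    simpa [norm_exp_ofReal_mul_I] using hR
  have hmemx : ∀ x ∈ Set.uIcc (-1 : ℝ) 1, (x : ℂ) ∈ ball (0 : ℂ) R := fun x hx => by
    rw [Set.uIcc_of_le (by norm_num)] at hx
    simpa using (abs_le.2 hx).trans_lt hR
  have h1 : ∫ x in (-1 : ℝ)..1, K x = Φ (1 : ℝ) - Φ (-1 : ℝ) := by
    refine intervalIntegral.integral_eq_sub_of_hasDerivAt (f := fun x : ℝ => Φ x)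
      (fun x hx => ?_) ?_
    · exact (hΦ _ (hmemx x hx)).comp_ofReal
    · refine ContinuousOn.intervalIntegrable ?_
      exact hK.continuousOn.comp continuous_ofReal.continuousOn hmemx
  have h2 : ∫ θ in (0 : ℝ)..Real.pi, K (exp (θ * I)) * (exp (θ * I) * I)
      = Φ (exp ((Real.pi : ℝ) * I)) - Φ (exp ((0 : ℝ) * I)) := by
    refine intervalIntegral.integral_eq_sub_of_hasDerivAt (f := fun θ : ℝ => Φ (exp (θ * I)))
      (fun θ _ => ?_) ?_
    · have he : HasDerivAt (fun θ : ℝ => exp (θ * I)) (exp (θ * I) * I) θ := by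
        simpa using ((hasDerivAt_id (θ : ℂ)).mul_const I).cexp.comp_ofReal
      exact (hΦ _ (hmem θ)).comp θ he
    · refine Continuous.intervalIntegrable ?_ _ _
      have : Continuous fun θ : ℝ => K (exp (θ * I)) :=
        hK.continuousOn.comp_continuous (by fun_prop) hmem
      exact this.mul (by fun_prop)
  rw [h1, h2]
  simp [exp_pi_mul_I]

/-- The Fejér–Riesz inequality for exponent two. -/
theorem integral_norm_sq_diameter_le {S : ℂ → ℂ} {R : ℝ} (hR : 1 < R)
    (hS : DifferentiableOn ℂ S (ball 0 R)) :
    ∫ x in (-1 : ℝ)..1, ‖S x‖ ^ 2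
      ≤ 1 / 2 * ∫ θ in (0 : ℝ)..(2 * Real.pi), ‖S (exp (θ * I))‖ ^ 2 := by
  -- Reflection makes `K` analytic, with `K = |S|²` on the real axis. On the circle `|K|` is a
  -- product of values of `|S|` at conjugate points.
  set K : ℂ → ℂ := fun z => S z * (starRingEnd ℂ) (S ((starRingEnd ℂ) z)) with hKdef
  have hK : DifferentiableOn ℂ K (ball 0 R) := by
    refine hS.mul fun z hz => ?_
    have hz' : (starRingEnd ℂ) z ∈ ball (0 : ℂ) R := by simpa using hz
    have := (hS.differentiableAt (isOpen_ball.mem_nhds hz')).conj_conj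
    rw [Complex.conj_conj] at this
    exact this.differentiableWithinAt
  have hmem : ∀ θ : ℝ, exp (θ * I) ∈ ball (0 : ℂ) R := fun θ => by
    simpa [norm_exp_ofReal_mul_I] using hR
  have hcont : Continuous fun θ : ℝ => S (exp (θ * I)) :=
    hS.continuousOn.comp_continuous (by fun_prop) hmem
  have hcont' : Continuous fun θ : ℝ => ‖S (exp (θ * I))‖ ^ 2 := hcont.norm.pow 2
  have hcontneg : Continuous fun θ : ℝ => ‖S (exp ((-θ : ℝ) * I))‖ ^ 2 :=
    hcont'.comp continuous_neg
  have hdiam : ((∫ x in (-1 : ℝ)..1, ‖S x‖ ^ 2 : ℝ) : ℂ) = ∫ x in (-1 : ℝ)..1, K x := by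
    rw [← intervalIntegral.integral_ofReal]
    congr 1 with x
    simp only [hKdef, conj_ofReal, mul_conj, normSq_eq_norm_sq]
  have hper : Function.Periodic (fun θ : ℝ => ‖S (exp (θ * I))‖ ^ 2) (2 * Real.pi) := fun θ => by
    have : exp (((θ + 2 * Real.pi : ℝ) : ℂ) * I) = exp (θ * I) := by
      push_cast
      rw [add_mul, exp_add, exp_two_pi_mul_I, mul_one]
    simp only [this]
  have hreflect : ∫ θ in (0 : ℝ)..Real.pi, ‖S (exp ((-θ : ℝ) * I))‖ ^ 2
      = ∫ θ in (-Real.pi)..0, ‖S (exp (θ * I))‖ ^ 2 := by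
    simpa using intervalIntegral.integral_comp_neg (a := 0) (b := Real.pi)
      (fun θ : ℝ => ‖S (exp (θ * I))‖ ^ 2)
  calc ∫ x in (-1 : ℝ)..1, ‖S x‖ ^ 2
      ≤ ‖∫ x in (-1 : ℝ)..1, K x‖ := by
        rw [← hdiam, norm_real]
        exact le_abs_self _
    _ ≤ ∫ θ in (0 : ℝ)..Real.pi,
          (‖S (exp (θ * I))‖ ^ 2 + ‖S (exp ((-θ : ℝ) * I))‖ ^ 2) / 2 := by
        rw [integral_diameter_eq_integral_semicircle hR hK, norm_neg]
        refine intervalIntegral.norm_integral_le_of_norm_le Real.pi_pos.le (ae_of_all _ ?_)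
          ((hcont'.add hcontneg).div_const 2 |>.intervalIntegrable _ _)
        intro θ _
        have hc : (starRingEnd ℂ) (exp (θ * I)) = exp ((-θ : ℝ) * I) := by
          rw [← exp_conj]; simp
        simp only [hKdef, hc, norm_mul, norm_exp_ofReal_mul_I, norm_I, mul_one,
          RCLike.norm_conj]
        nlinarith [sq_nonneg (‖S (exp (θ * I))‖ - ‖S (exp ((-θ : ℝ) * I))‖)]
    _ = 1 / 2 * ∫ θ in (0 : ℝ)..(2 * Real.pi), ‖S (exp (θ * I))‖ ^ 2 := by
        rw [intervalIntegral.integral_div, intervalIntegral.integral_add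
          (hcont'.intervalIntegrable _ _) (hcontneg.intervalIntegrable _ _), hreflect, add_comm,
          intervalIntegral.integral_add_adjacent_intervals (hcont'.intervalIntegrable _ _)
          (hcont'.intervalIntegrable _ _)]
        have := hper.intervalIntegral_add_eq (-Real.pi) 0
        rw [show -Real.pi + 2 * Real.pi = Real.pi by ring, zero_add] at this
        rw [this]; ring

/-- The square roots built below are analytic only in the open disk and continuous up to the circle,
whereas the exponent-two inequality needs a larger disk; dilation bridges the gap. -/
theorem tendsto_integral_norm_sq_dilate {S : ℂ → ℂ} (hS : ContinuousOn S (closedBall 0 1))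
    {γ : ℝ → ℂ} (hγ : Continuous γ) {a b : ℝ} (hγ1 : ∀ x ∈ Set.uIoc a b, ‖γ x‖ ≤ 1) :
    Tendsto (fun r : ℝ => ∫ x in a..b, ‖S (r * γ x)‖ ^ 2) (𝓝[<] 1)
      (𝓝 (∫ x in a..b, ‖S (γ x)‖ ^ 2)) := by
  obtain ⟨B, hB⟩ := (isCompact_closedBall (0 : ℂ) 1).exists_bound_of_continuousOn hS
  have hr : ∀ᶠ r : ℝ in 𝓝[<] 1, r ∈ Set.Ioo (0 : ℝ) 1 := Ioo_mem_nhdsLT (by norm_num)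
  have hmem : ∀ r ∈ Set.Ioc (0 : ℝ) 1, ∀ x ∈ Set.uIoc a b,
      (r : ℂ) * γ x ∈ closedBall (0 : ℂ) 1 := fun r hr x hx => by
    rw [mem_closedBall_zero_iff, norm_mul, norm_real, Real.norm_of_nonneg hr.1.le]
    exact mul_le_one₀ hr.2 (norm_nonneg _) (hγ1 x hx)
  refine intervalIntegral.tendsto_integral_filter_of_dominated_convergence (fun _ => B ^ 2) ?_ ?_
    (by simp) (ae_of_all _ fun x hx => ?_)
  · filter_upwards [hr] with r hr
    refine ContinuousOn.aestronglyMeasurable ?_ measurableSet_uIoc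
    have : ContinuousOn (fun x => S (r * γ x)) (Set.uIoc a b) :=
      hS.comp (by fun_prop) (hmem r ⟨hr.1, hr.2.le⟩)
    exact this.norm.pow 2
  · filter_upwards [hr] with r hr
    refine ae_of_all _ fun x hx => ?_
    rw [norm_pow, norm_norm]
    exact pow_le_pow_left₀ (norm_nonneg _) (hB _ (hmem r ⟨hr.1, hr.2.le⟩ x hx)) 2
  · have h1 : γ x ∈ closedBall (0 : ℂ) 1 := by simpa using hγ1 x hx
    have ht : Tendsto (fun r : ℝ => (r : ℂ) * γ x) (𝓝[<] 1) (𝓝[closedBall 0 1] (γ x)) := by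
      refine tendsto_nhdsWithin_iff.2 ⟨?_, ?_⟩
      · have : Continuous fun r : ℝ => (r : ℂ) * γ x := by fun_prop
        simpa using (this.tendsto 1).mono_left nhdsWithin_le_nhds
      · filter_upwards [hr] with r hr using hmem r ⟨hr.1, hr.2.le⟩ x hx
    exact (((hS _ h1).tendsto.comp ht).norm).pow 2

/-- `‖F‖` is dominated in the closed unit disk by `‖S‖ ^ 2`, with equality on the circle. -/
structure IsSqrtMajorant (F S : ℂ → ℂ) : Prop where
  differentiableOn : DifferentiableOn ℂ S (ball 0 1)
  continuousOn : ContinuousOn S (closedBall 0 1)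
  norm_le : ∀ z, ‖z‖ ≤ 1 → ‖F z‖ ≤ ‖S z‖ ^ 2
  norm_eq : ∀ z, ‖z‖ = 1 → ‖S z‖ ^ 2 = ‖F z‖

theorem IsSqrtMajorant.mul {F G S T : ℂ → ℂ} (hF : IsSqrtMajorant F S)
    (hG : IsSqrtMajorant G T) : IsSqrtMajorant (fun z => F z * G z) (fun z => S z * T z) where
  differentiableOn := hF.differentiableOn.mul hG.differentiableOn
  continuousOn := hF.continuousOn.mul hG.continuousOn
  norm_le z hz := by
    rw [norm_mul, norm_mul, mul_pow]
    exact mul_le_mul (hF.norm_le z hz) (hG.norm_le z hz) (norm_nonneg _) (by positivity)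
  norm_eq z hz := by
    rw [norm_mul, norm_mul, mul_pow, hF.norm_eq z hz, hG.norm_eq z hz]

theorem sq_cpow_half (z : ℂ) : (z ^ ((2 : ℂ)⁻¹)) ^ 2 = z := by
  simp

theorem norm_sq_cpow_half (z : ℂ) : ‖z ^ ((2 : ℂ)⁻¹)‖ ^ 2 = ‖z‖ := by
  rw [← norm_pow, sq_cpow_half]

theorem isSqrtMajorant_const (c : ℂ) :
    IsSqrtMajorant (fun _ => c) (fun _ => c ^ ((2 : ℂ)⁻¹)) where
  differentiableOn := differentiableOn_const _
  continuousOn := continuousOn_const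
  norm_le _ _ := (norm_sq_cpow_half c).ge
  norm_eq _ _ := norm_sq_cpow_half c

/-- On the closed disk `1 - wz` has nonnegative real part, so the principal square root stays off
its cut and is continuous even at a boundary zero. -/
theorem isSqrtMajorant_one_sub_mul {w : ℂ} (hw : ‖w‖ ≤ 1) :
    IsSqrtMajorant (fun z => 1 - w * z) (fun z => (1 - w * z) ^ ((2 : ℂ)⁻¹)) where
  differentiableOn z hz := by
    have hz1 : ‖z‖ < 1 := by simpa using hz
    have hlt : ‖w * z‖ < 1 := by
      rw [norm_mul]
      exact (mul_le_of_le_one_left (norm_nonneg _) hw).trans_lt hz1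
    have hs : 1 - w * z ∈ slitPlane := Or.inl (by
      have := (re_le_norm (w * z)).trans_lt hlt
      simp only [sub_re, one_re]; linarith)
    exact ((differentiableAt_const _).sub (differentiableAt_id.const_mul w)).cpow_const hs
      |>.differentiableWithinAt
  continuousOn z hz := by
    have hz1 : ‖z‖ ≤ 1 := by simpa using hz
    have hle : ‖w * z‖ ≤ 1 := by
      rw [norm_mul]; exact mul_le_one₀ hw (norm_nonneg _) hz1
    have hre : 0 ≤ (1 - w * z).re := by
      have := (re_le_norm (w * z)).trans hle
      simp only [sub_re, one_re]; linarith
    have h1 : ContinuousAt (fun x : ℂ => x ^ ((2 : ℂ)⁻¹)) (1 - w * z) :=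
      continuousAt_cpow_const_of_re_pos (Or.inl hre) (by norm_num)
    have h2 : ContinuousAt (fun z : ℂ => 1 - w * z) z := by fun_prop
    exact (ContinuousAt.comp (f := fun z : ℂ => 1 - w * z) h1 h2).continuousWithinAt
  norm_le z _ := (norm_sq_cpow_half _).ge
  norm_eq z _ := norm_sq_cpow_half _

/-- A zero with `|a| ≤ 1` is reflected: `1 - conj(a) z` has the modulus of `z - a` on the circle and
at least that modulus inside. If `|a| > 1`, then `z - a` already is a constant times `1 - z/a`. -/
theorem exists_isSqrtMajorant_sub (a : ℂ) : ∃ S, IsSqrtMajorant (fun z => z - a) S := by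
  rcases le_or_gt ‖a‖ 1 with ha | ha
  · have h := isSqrtMajorant_one_sub_mul (w := (starRingEnd ℂ) a) (by simpa using ha)
    have key : ∀ z : ℂ, ‖1 - (starRingEnd ℂ) a * z‖ ^ 2 - ‖z - a‖ ^ 2
        = (1 - ‖a‖ ^ 2) * (1 - ‖z‖ ^ 2) := fun z => by
      simp only [← normSq_eq_norm_sq, normSq_apply, sub_re, sub_im, mul_re, mul_im, conj_re,
        conj_im, one_re, one_im]
      ring
    refine ⟨_, h.differentiableOn, h.continuousOn, fun z hz => ?_, fun z hz => ?_⟩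
    · refine le_trans ?_ (h.norm_le z hz)
      refine le_of_sq_le_sq ?_ (norm_nonneg _)
      have h1 : 0 ≤ 1 - ‖a‖ ^ 2 := by nlinarith [norm_nonneg a]
      have h2 : 0 ≤ 1 - ‖z‖ ^ 2 := by nlinarith [norm_nonneg z]
      nlinarith [key z, mul_nonneg h1 h2]
    · rw [h.norm_eq z hz]
      refine (sq_eq_sq₀ (norm_nonneg _) (norm_nonneg _)).1 ?_
      have := key z
      rw [hz] at this
      linarith
  · have ha0 : a ≠ 0 := norm_pos_iff.1 (by linarith)
    have h := (isSqrtMajorant_const (-a)).mul (isSqrtMajorant_one_sub_mul (w := a⁻¹)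
      (by rw [norm_inv]; exact inv_le_one_of_one_le₀ ha.le))
    have he : (fun z => -a * (1 - a⁻¹ * z)) = fun z => z - a := by
      funext z
      field_simp
      ring
    exact ⟨_, he ▸ h⟩

theorem exists_isSqrtMajorant_polynomial (P : Polynomial ℂ) :
    ∃ S, IsSqrtMajorant (fun z => P.eval z) S := by
  have hs : P = Polynomial.C P.leadingCoeff *
      (P.roots.map fun a => Polynomial.X - Polynomial.C a).prod :=
    (IsAlgClosed.splits P).eq_prod_roots
  have hprod : ∀ m : Multiset ℂ, ∃ S, IsSqrtMajorant
      (fun z => ((m.map fun a => Polynomial.X - Polynomial.C a).prod).eval z) S := by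
    intro m
    induction m using Multiset.induction with
    | empty => exact ⟨_, by simpa using isSqrtMajorant_const 1⟩
    | cons a m ih =>
      obtain ⟨S, hS⟩ := ih
      obtain ⟨T, hT⟩ := exists_isSqrtMajorant_sub a
      exact ⟨_, by simpa using hT.mul hS⟩
  obtain ⟨S, hS⟩ := hprod P.roots
  have h := (isSqrtMajorant_const P.leadingCoeff).mul hS
  refine ⟨fun z => P.leadingCoeff ^ ((2 : ℂ)⁻¹) * S z, ?_⟩
  convert h using 2 with z
  conv_lhs => rw [hs]
  simp only [Polynomial.eval_mul, Polynomial.eval_C]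

/-- The exponent-two inequality for the majorant `S` suffices: replacing `|P|` by `|S|²` can only
increase the diameter integral and leaves the circle integral unchanged. -/
theorem integral_norm_polynomial_diameter_le (P : Polynomial ℂ) :
    ∫ x in (-1 : ℝ)..1, ‖P.eval (x : ℂ)‖
      ≤ 1 / 2 * ∫ θ in (0 : ℝ)..(2 * Real.pi), ‖P.eval (exp (θ * I))‖ := by
  obtain ⟨S, hS⟩ := exists_isSqrtMajorant_polynomial P
  have hx : ∀ x ∈ Set.uIoc (-1 : ℝ) 1, ‖(x : ℂ)‖ ≤ 1 := fun x hx => by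
    rw [Set.uIoc_of_le (by norm_num)] at hx
    simpa using abs_le.2 ⟨hx.1.le, hx.2⟩
  have h1 := tendsto_integral_norm_sq_dilate hS.continuousOn continuous_ofReal hx
  have h2 := tendsto_integral_norm_sq_dilate hS.continuousOn (γ := fun θ : ℝ => exp (θ * I))
    (by fun_prop) (a := 0) (b := 2 * Real.pi) (fun θ _ => (norm_exp_ofReal_mul_I θ).le)
  have hle : ∫ x in (-1 : ℝ)..1, ‖S x‖ ^ 2
      ≤ 1 / 2 * ∫ θ in (0 : ℝ)..(2 * Real.pi), ‖S (exp (θ * I))‖ ^ 2 := by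
    refine le_of_tendsto_of_tendsto h1 (h2.const_mul (1 / 2)) ?_
    filter_upwards [Ioo_mem_nhdsLT (zero_lt_one' ℝ)] with r hr
    refine integral_norm_sq_diameter_le (S := fun z => S (r * z)) (R := r⁻¹)
      ((one_lt_inv₀ hr.1).2 hr.2) (hS.differentiableOn.comp (by fun_prop) fun z hz => ?_)
    rw [mem_ball_zero_iff] at hz ⊢
    rw [norm_mul, norm_real, Real.norm_of_nonneg hr.1.le]
    calc r * ‖z‖ < r * r⁻¹ := mul_lt_mul_of_pos_left hz hr.1
      _ = 1 := mul_inv_cancel₀ hr.1.ne'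
  calc ∫ x in (-1 : ℝ)..1, ‖P.eval (x : ℂ)‖
      ≤ ∫ x in (-1 : ℝ)..1, ‖S x‖ ^ 2 := by
        refine intervalIntegral.integral_mono_on (by norm_num) ?_ ?_ fun x hx => ?_
        · exact Continuous.intervalIntegrable (by fun_prop) _ _
        · refine ContinuousOn.intervalIntegrable ?_
          have : ContinuousOn (fun x : ℝ => S x) (Set.uIcc (-1) 1) := by
            refine hS.continuousOn.comp continuous_ofReal.continuousOn fun x hx => ?_
            rw [Set.uIcc_of_le (by norm_num)] at hx
            simpa using abs_le.2 hx
          exact this.norm.pow 2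
        · exact hS.norm_le _ (by simpa using abs_le.2 hx)
    _ ≤ _ := hle
    _ = _ := by
        congr 2 with θ
        exact hS.norm_eq _ (norm_exp_ofReal_mul_I θ)

theorem exists_hasSum_coeff_mul_pow {F : ℂ → ℂ} {R : ℝ} (hF : DifferentiableOn ℂ F (ball 0 R)) :
    ∃ a : ℕ → ℂ, ∀ z : ℂ, ‖z‖ < R → HasSum (fun n => a n * z ^ n) (F z) := by
  refine ⟨fun n => (n.factorial : ℂ)⁻¹ * iteratedDeriv n F 0, fun z hz => ?_⟩
  have h := hasSum_taylorSeries_on_ball hF (z := z) (by simpa using hz)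
  have he : (fun n : ℕ => (n.factorial : ℂ)⁻¹ * iteratedDeriv n F 0 * z ^ n)
      = fun n : ℕ => (n.factorial : ℂ)⁻¹ • (z - 0) ^ n • iteratedDeriv n F 0 := by
    funext n
    rw [sub_zero, smul_eq_mul, smul_eq_mul]
    ring
  rw [he]
  exact h

/-- The Fejér–Riesz inequality for exponent one. -/
theorem integral_norm_diameter_le {F : ℂ → ℂ} {R : ℝ} (hR : 1 < R)
    (hF : DifferentiableOn ℂ F (ball 0 R)) :
    ∫ x in (-1 : ℝ)..1, ‖F x‖ ≤ 1 / 2 * ∫ θ in (0 : ℝ)..(2 * Real.pi), ‖F (exp (θ * I))‖ := by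
  obtain ⟨a, hsum'⟩ := exists_hasSum_coeff_mul_pow hF
  have hsum : ∀ z : ℂ, ‖z‖ ≤ 1 → HasSum (fun n => a n * z ^ n) (F z) :=
    fun z hz => hsum' z (hz.trans_lt hR)
  have hnorm : Summable fun n => ‖a n‖ := by
    simpa using (hsum 1 (by simp)).summable.norm
  -- Since `1 < R`, the Taylor series converges absolutely on the closed disk, so `∑ |a n|`
  -- dominates every partial sum there.
  let P : ℕ → Polynomial ℂ := fun N =>
    ∑ n ∈ Finset.range N, Polynomial.C (a n) * Polynomial.X ^ n
  have hP : ∀ N z, (P N).eval z = ∑ n ∈ Finset.range N, a n * z ^ n := fun N z => by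
    simp [P, Polynomial.eval_finsetSum]
  have hlim : ∀ {γ : ℝ → ℂ} {c d : ℝ}, Continuous γ → (∀ x ∈ Set.uIoc c d, ‖γ x‖ ≤ 1) →
      Tendsto (fun N => ∫ x in c..d, ‖(P N).eval (γ x)‖) atTop
        (𝓝 (∫ x in c..d, ‖F (γ x)‖)) := by
    intro γ c d hγ hγ1
    refine intervalIntegral.tendsto_integral_filter_of_dominated_convergence
      (fun _ => ∑' n, ‖a n‖) ?_ ?_ (by simp) (ae_of_all _ fun x hx => ?_)
    · refine Eventually.of_forall fun N => Continuous.aestronglyMeasurable ?_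
      exact ((P N).continuous.comp hγ).norm
    · refine Eventually.of_forall fun N => ae_of_all _ fun x hx => ?_
      rw [norm_norm, hP]
      refine (norm_sum_le _ _).trans (le_trans (Finset.sum_le_sum fun n _ => ?_)
        (hnorm.sum_le_tsum (Finset.range N) fun n _ => norm_nonneg _))
      rw [norm_mul, norm_pow]
      exact mul_le_of_le_one_right (norm_nonneg _) (pow_le_one₀ (norm_nonneg _) (hγ1 x hx))
    · simp only [hP]
      exact (hsum _ (hγ1 x hx)).tendsto_sum_nat.norm
  refine le_of_tendsto_of_tendsto' (hlim continuous_ofReal fun x hx => ?_)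
    ((hlim (γ := fun θ : ℝ => exp (θ * I)) (by fun_prop)
      fun θ _ => (norm_exp_ofReal_mul_I θ).le).const_mul (1 / 2))
    fun N => integral_norm_polynomial_diameter_le (P N)
  rw [Set.uIoc_of_le (by norm_num)] at hx
  simpa using abs_le.2 ⟨hx.1.le, hx.2⟩

end FejerRiesz

noncomputable section

/-! ### The Poisson kernel and Fatou's theorem at a point. -/

section PoissonKernel

/-- The Poisson kernel of the unit disk in polar coordinates. -/
def polarPoisson (r s : ℝ) : ℝ := (1 - r ^ 2) / (1 - 2 * r * Real.cos s + r ^ 2)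

/-- The derivative of `polarPoisson r` in the angle. -/
def polarPoissonDeriv (r s : ℝ) : ℝ :=
  -((1 - r ^ 2) * (2 * r * Real.sin s)) / (1 - 2 * r * Real.cos s + r ^ 2) ^ 2

theorem polarPoisson_denom_pos {r : ℝ} (h0 : 0 ≤ r) (h1 : r < 1) (s : ℝ) :
    0 < 1 - 2 * r * Real.cos s + r ^ 2 := by
  nlinarith [mul_le_of_le_one_right h0 (Real.cos_le_one s), sq_nonneg (1 - r), sub_pos.2 h1]

theorem hasDerivAt_polarPoisson {r : ℝ} (h0 : 0 ≤ r) (h1 : r < 1) (s : ℝ) :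
    HasDerivAt (polarPoisson r) (polarPoissonDeriv r s) s := by
  have hd : HasDerivAt (fun s => 1 - 2 * r * Real.cos s + r ^ 2) (2 * r * Real.sin s) s := by
    have := (((Real.hasDerivAt_cos s).const_mul (2 * r)).const_sub 1).add_const (r ^ 2)
    simpa using this
  have := (hasDerivAt_const s (1 - r ^ 2)).div hd (polarPoisson_denom_pos h0 h1 s).ne'
  unfold polarPoissonDeriv
  convert! this using 1
  ring

theorem continuous_polarPoisson {r : ℝ} (h0 : 0 ≤ r) (h1 : r < 1) :
    Continuous (polarPoisson r) :=
  continuous_iff_continuousAt.2 fun s => (hasDerivAt_polarPoisson h0 h1 s).continuousAt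

theorem continuous_polarPoissonDeriv {r : ℝ} (h0 : 0 ≤ r) (h1 : r < 1) :
    Continuous (polarPoissonDeriv r) := by
  unfold polarPoissonDeriv
  exact Continuous.div (by fun_prop) (by fun_prop)
    fun s => (pow_pos (polarPoisson_denom_pos h0 h1 s) 2).ne'

theorem poissonKernel_circleMap_add {r : ℝ} (θ s : ℝ) :
    poissonKernel 0 ((r : ℂ) * Complex.exp ((θ : ℂ) * Complex.I)) (circleMap 0 1 (θ + s))
      = polarPoisson r s := by
  have hn : ‖Complex.exp (s * Complex.I) - r‖ ^ 2 = 1 - 2 * r * Real.cos s + r ^ 2 := by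
    rw [← Complex.normSq_eq_norm_sq, Complex.normSq_apply]
    simp only [Complex.sub_re, Complex.sub_im, Complex.exp_ofReal_mul_I_re,
      Complex.exp_ofReal_mul_I_im, Complex.ofReal_re, Complex.ofReal_im]
    nlinarith [Real.sin_sq_add_cos_sq s]
  have hfac : circleMap 0 1 (θ + s) - (r : ℂ) * Complex.exp ((θ : ℂ) * Complex.I)
      = Complex.exp ((θ : ℂ) * Complex.I) * (Complex.exp (s * Complex.I) - r) := by
    simp only [circleMap, Complex.ofReal_add, add_mul, Complex.exp_add]
    push_cast
    ring
  rw [poissonKernel_def, sub_zero, sub_zero, hfac, norm_mul, norm_mul,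
    Complex.norm_exp_ofReal_mul_I, one_mul, hn, mul_one, Complex.norm_real,
    norm_circleMap_zero, Real.norm_eq_abs, sq_abs, sq_abs, one_pow]
  rfl

theorem integral_polarPoisson {r : ℝ} (h0 : 0 ≤ r) (h1 : r < 1) :
    ∫ s in (-Real.pi)..Real.pi, polarPoisson r s = 2 * Real.pi := by
  have hw : (r : ℂ) ∈ Metric.ball (0 : ℂ) 1 := by
    simpa [abs_of_nonneg h0] using h1
  -- The total mass comes from Poisson's formula for the constant function `1`.
  have h := (diffContOnCl_const (𝕜 := ℂ) (c := (1 : ℝ → ℂ) 0)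
    (s := Metric.ball (0 : ℂ) 1)).circleAverage_poissonKernel_smul hw
  have hk : ∀ s : ℝ, poissonKernel 0 (r : ℂ) (circleMap 0 1 s) = polarPoisson r s := fun s => by
    simpa using poissonKernel_circleMap_add (r := r) 0 s
  simp only [Real.circleAverage_def, Pi.smul_apply', hk, Pi.one_apply] at h
  have h2 : ∫ s in (0 : ℝ)..(2 * Real.pi), polarPoisson r s = 2 * Real.pi := by
    have h3 : (∫ s in (0 : ℝ)..(2 * Real.pi), polarPoisson r s • (1 : ℂ))
        = ((∫ s in (0 : ℝ)..(2 * Real.pi), polarPoisson r s : ℝ) : ℂ) := by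
      rw [← intervalIntegral.integral_ofReal]
      simp
    rw [h3, Complex.real_smul, ← Complex.ofReal_mul] at h
    have h4 : (2 * Real.pi)⁻¹ * ∫ s in (0 : ℝ)..(2 * Real.pi), polarPoisson r s = 1 := by
      exact_mod_cast h
    have := Real.pi_pos
    field_simp at h4
    linarith
  have hper : Function.Periodic (polarPoisson r) (2 * Real.pi) := fun s => by
    simp [polarPoisson]
  have := hper.intervalIntegral_add_eq (-Real.pi) 0
  rw [show -Real.pi + 2 * Real.pi = Real.pi by ring, zero_add] at this
  rw [this, h2]

/-- The kernel decreases away from the peak. Hence `|s P'(s)| = -s P'(s)`, whose integral is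
accessible by parts. -/
theorem mul_polarPoissonDeriv_nonpos {r : ℝ} (h0 : 0 ≤ r) (h1 : r < 1) {s : ℝ}
    (hs : |s| ≤ Real.pi) : s * polarPoissonDeriv r s ≤ 0 := by
  have hss : 0 ≤ s * Real.sin s := by
    rcases le_total 0 s with h | h
    · exact mul_nonneg h (Real.sin_nonneg_of_nonneg_of_le_pi h (abs_le.1 hs).2)
    · exact mul_nonneg_of_nonpos_of_nonpos h
        (Real.sin_nonpos_of_nonpos_of_neg_pi_le h (abs_le.1 hs).1)
  have : s * polarPoissonDeriv r s = -((1 - r ^ 2) * (2 * r) * (s * Real.sin s)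
      / (1 - 2 * r * Real.cos s + r ^ 2) ^ 2) := by
    unfold polarPoissonDeriv; ring
  rw [this, neg_nonpos]
  have : 0 ≤ 1 - r ^ 2 := by nlinarith
  positivity

/-- Away from the peak the denominator is at least `1 - 2r cos δ + r² = (r - cos δ)² + sin² δ`, so
the factor `1 - r²` forces decay. -/
theorem abs_polarPoissonDeriv_le {r : ℝ} (h0 : 0 ≤ r) (h1 : r < 1) {δ s : ℝ} (hδ : 0 < δ)
    (hδs : δ ≤ |s|) (hs : |s| ≤ Real.pi) (hδπ : δ < Real.pi) :
    |polarPoissonDeriv r s| ≤ 2 * (1 - r ^ 2) / Real.sin δ ^ 4 := by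
  have hsin : 0 < Real.sin δ := Real.sin_pos_of_pos_of_lt_pi hδ hδπ
  have hcos : Real.cos s ≤ Real.cos δ := by
    rw [← Real.cos_abs s]
    exact Real.cos_le_cos_of_nonneg_of_le_pi hδ.le hs hδs
  have hD : Real.sin δ ^ 2 ≤ 1 - 2 * r * Real.cos s + r ^ 2 := by
    nlinarith [Real.sin_sq_add_cos_sq δ, sq_nonneg (r - Real.cos δ),
      mul_le_mul_of_nonneg_left hcos h0]
  have hr : 0 ≤ 1 - r ^ 2 := by nlinarith
  unfold polarPoissonDeriv
  have h2r : |2 * r| = 2 * r := abs_of_nonneg (by positivity)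
  rw [abs_div, abs_neg, abs_mul, abs_of_nonneg hr, abs_mul, h2r, abs_sq]
  refine div_le_div₀ (by positivity) ?_ (by positivity) ?_
  · have : 2 * r * |Real.sin s| ≤ 2 := by
      nlinarith [Real.abs_sin_le_one s, abs_nonneg (Real.sin s)]
    nlinarith
  · calc Real.sin δ ^ 4 = (Real.sin δ ^ 2) ^ 2 := by ring
      _ ≤ _ := pow_le_pow_left₀ (by positivity) hD 2

theorem integral_neg_mul_polarPoissonDeriv_le {r : ℝ} (h0 : 0 ≤ r) (h1 : r < 1) :
    ∫ s in (-Real.pi)..Real.pi, -(s * polarPoissonDeriv r s) ≤ 2 * Real.pi := by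
  have hparts := intervalIntegral.integral_mul_deriv_eq_deriv_mul (a := -Real.pi) (b := Real.pi)
    (u := fun s : ℝ => s) (u' := fun _ => 1) (v := polarPoisson r) (v' := polarPoissonDeriv r)
    (fun s _ => hasDerivAt_id s) (fun s _ => hasDerivAt_polarPoisson h0 h1 s)
    (by simp) ((continuous_polarPoissonDeriv h0 h1).intervalIntegrable _ _)
  rw [intervalIntegral.integral_neg, hparts]
  simp only [one_mul]
  rw [integral_polarPoisson h0 h1]
  have hp : ∀ s, 0 ≤ polarPoisson r s := fun s =>
    div_nonneg (by nlinarith) (polarPoisson_denom_pos h0 h1 s).le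
  nlinarith [hp Real.pi, hp (-Real.pi), Real.pi_pos]

/-- Integration by parts trades `ψ` for its primitive, which is small relative to `|s|` near `0`.
The three terms of the bound come from the endpoints, from `|s| ≤ δ` and from `|s| ≥ δ`. -/
theorem abs_integral_polarPoisson_mul_le {ψ : ℝ → ℝ}
    (hψ : IntervalIntegrable ψ volume (-Real.pi) Real.pi) {r δ ε B : ℝ}
    (h0 : 0 ≤ r) (h1 : r < 1) (hδ : 0 < δ) (hδπ : δ < Real.pi) (hε : 0 ≤ ε)
    (hsmall : ∀ s, |s| ≤ δ → |∫ x in (0 : ℝ)..s, ψ x| ≤ ε * |s|)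
    (hB : ∀ s, |s| ≤ Real.pi → |∫ x in (0 : ℝ)..s, ψ x| ≤ B) :
    |∫ s in (-Real.pi)..Real.pi, polarPoisson r s * ψ s|
      ≤ 2 * B * ((1 - r ^ 2) / (1 + r) ^ 2)
        + (ε * (2 * Real.pi) + 2 * Real.pi * (2 * (1 - r ^ 2) / Real.sin δ ^ 4 * B)) := by
  have hπ := Real.pi_pos
  have hle : -Real.pi ≤ Real.pi := by linarith
  have h0mem : (0 : ℝ) ∈ Set.uIcc (-Real.pi) Real.pi := by
    rw [Set.uIcc_of_le hle]; constructor <;> linarith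
  set Ψ : ℝ → ℝ := fun s => ∫ x in (0 : ℝ)..s, ψ x with hΨ
  have hr : 0 ≤ 1 - r ^ 2 := by nlinarith
  have hB0 : 0 ≤ B := (abs_nonneg _).trans (hB 0 (by simpa using hπ.le))
  -- As `ψ` is merely integrable, integration by parts is used in its absolutely continuous form.
  have hac : AbsolutelyContinuousOnInterval Ψ (-Real.pi) Real.pi :=
    hψ.absolutelyContinuousOnInterval_intervalIntegral h0mem
  have hPac : AbsolutelyContinuousOnInterval (polarPoisson r) (-Real.pi) Real.pi := by
    refine ContDiffOn.absolutelyContinuousOnInterval (ContDiff.contDiffOn ?_)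
    rw [contDiff_one_iff_deriv]
    refine ⟨fun s => (hasDerivAt_polarPoisson h0 h1 s).differentiableAt, ?_⟩
    rw [show deriv (polarPoisson r) = polarPoissonDeriv r from
      funext fun s => (hasDerivAt_polarPoisson h0 h1 s).deriv]
    exact continuous_polarPoissonDeriv h0 h1
  have hparts := hPac.integral_mul_deriv_eq_deriv_mul hac
  have hderiv : ∫ s in (-Real.pi)..Real.pi, polarPoisson r s * deriv Ψ s
      = ∫ s in (-Real.pi)..Real.pi, polarPoisson r s * ψ s := by
    refine intervalIntegral.integral_congr_ae ?_
    filter_upwards [hψ.ae_hasDerivAt_integral] with s hs hmem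
    rw [(hs (Set.uIoc_subset_uIcc hmem) 0 h0mem).deriv]
  rw [hderiv] at hparts
  rw [hparts]
  have hPπ : polarPoisson r Real.pi = (1 - r ^ 2) / (1 + r) ^ 2 := by
    simp only [polarPoisson, Real.cos_pi]; congr 1; ring
  have hPπ' : polarPoisson r (-Real.pi) = (1 - r ^ 2) / (1 + r) ^ 2 := by
    simp only [polarPoisson, Real.cos_neg, Real.cos_pi]; congr 1; ring
  have hbdry : |polarPoisson r Real.pi * Ψ Real.pi - polarPoisson r (-Real.pi) * Ψ (-Real.pi)|
      ≤ 2 * B * ((1 - r ^ 2) / (1 + r) ^ 2) := by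
    rw [hPπ, hPπ', ← mul_sub, abs_mul, abs_of_nonneg (by positivity)]
    have h2 : |Ψ Real.pi - Ψ (-Real.pi)| ≤ 2 * B := by
      refine (abs_sub _ _).trans ?_
      have h3 := hB Real.pi (by rw [abs_of_pos hπ])
      have h4 := hB (-Real.pi) (by rw [abs_neg, abs_of_pos hπ])
      linarith
    have h5 : 0 ≤ (1 - r ^ 2) / (1 + r) ^ 2 := by positivity
    nlinarith
  set A : ℝ := 2 * (1 - r ^ 2) / Real.sin δ ^ 4 * B with hA
  have hA0 : 0 ≤ A := by
    have : 0 ≤ Real.sin δ ^ 4 := by positivity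
    positivity
  have hcontmul : Continuous fun s => -(s * polarPoissonDeriv r s) :=
    (continuous_id.mul (continuous_polarPoissonDeriv h0 h1)).neg
  -- Both summands of the majorant are nonnegative, so their sum dominates the integrand in either
  -- range of `s`.
  have hint : |∫ s in (-Real.pi)..Real.pi, deriv (polarPoisson r) s * Ψ s|
      ≤ ∫ s in (-Real.pi)..Real.pi, (ε * -(s * polarPoissonDeriv r s) + A) := by
    rw [← Real.norm_eq_abs]
    refine intervalIntegral.norm_integral_le_of_norm_le hle (ae_of_all _ fun s hs => ?_)
      (((hcontmul.const_mul ε).add_const A).intervalIntegrable _ _)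
    have hs' : |s| ≤ Real.pi := abs_le.2 ⟨hs.1.le, hs.2⟩
    have hneg := mul_polarPoissonDeriv_nonpos h0 h1 hs'
    rw [(hasDerivAt_polarPoisson h0 h1 s).deriv, Real.norm_eq_abs, abs_mul]
    have hab : |polarPoissonDeriv r s| * |s| = -(s * polarPoissonDeriv r s) := by
      rw [← abs_of_nonpos hneg, abs_mul, mul_comm]
    rcases le_total |s| δ with h | h
    · calc |polarPoissonDeriv r s| * |Ψ s| ≤ |polarPoissonDeriv r s| * (ε * |s|) :=
            mul_le_mul_of_nonneg_left (hsmall s h) (abs_nonneg _)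
        _ = ε * (|polarPoissonDeriv r s| * |s|) := by ring
        _ ≤ _ := by rw [hab]; linarith
    · calc |polarPoissonDeriv r s| * |Ψ s|
          ≤ 2 * (1 - r ^ 2) / Real.sin δ ^ 4 * B :=
            mul_le_mul (abs_polarPoissonDeriv_le h0 h1 hδ h hs' hδπ) (hB s hs') (abs_nonneg _)
              (by have : 0 ≤ Real.sin δ ^ 4 := by positivity
                  positivity)
        _ ≤ _ := by
            have : 0 ≤ ε * -(s * polarPoissonDeriv r s) := mul_nonneg hε (by linarith)
            linarith
  rw [intervalIntegral.integral_add ((hcontmul.const_mul ε).intervalIntegrable _ _) (by simp),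
    intervalIntegral.integral_const_mul, intervalIntegral.integral_const, smul_eq_mul] at hint
  have hI := mul_le_mul_of_nonneg_left (integral_neg_mul_polarPoissonDeriv_le h0 h1) hε
  refine (abs_sub _ _).trans (add_le_add hbdry (hint.trans ?_))
  linarith

/-- Fatou's theorem at a single point: Poisson means of `ψ` converge to the derivative of the
primitive of `ψ`, wherever that derivative exists. -/
theorem tendsto_integral_polarPoisson_mul {ψ : ℝ → ℝ}
    (hψ : IntervalIntegrable ψ volume (-Real.pi) Real.pi) {c : ℝ}
    (hc : HasDerivAt (fun s => ∫ x in (0 : ℝ)..s, ψ x) c 0) :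
    Tendsto (fun r => (2 * Real.pi)⁻¹ * ∫ s in (-Real.pi)..Real.pi, polarPoisson r s * ψ s)
      (𝓝[<] 1) (𝓝 c) := by
  have hπ := Real.pi_pos
  have hle : -Real.pi ≤ Real.pi := by linarith
  -- Subtracting `c` makes the primitive `o(s)` at `0`; the constant is restored at the end through
  -- the total mass of the kernel.
  set ψ₀ : ℝ → ℝ := fun s => ψ s - c with hψ₀
  have hψ₀i : IntervalIntegrable ψ₀ volume (-Real.pi) Real.pi := hψ.sub (by simp)
  have hsub : ∀ s, |s| ≤ Real.pi → IntervalIntegrable ψ volume 0 s := fun s hs => by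
    refine hψ.mono_set ?_
    rw [Set.uIcc_of_le hle]
    refine Set.uIcc_subset_Icc ⟨by linarith, hπ.le⟩ (abs_le.1 hs)
  have hprim : ∀ s, |s| ≤ Real.pi →
      ∫ x in (0 : ℝ)..s, ψ₀ x = (∫ x in (0 : ℝ)..s, ψ x) - c * s := fun s hs => by
    rw [intervalIntegral.integral_sub (hsub s hs) (by simp)]
    simp [mul_comm]
  have hlim0 : Tendsto (fun r => ∫ s in (-Real.pi)..Real.pi, polarPoisson r s * ψ₀ s)
      (𝓝[<] 1) (𝓝 0) := by
    obtain ⟨B, hB⟩ : ∃ B, ∀ s, |s| ≤ Real.pi → |∫ x in (0 : ℝ)..s, ψ₀ x| ≤ B := by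
      have hcont := intervalIntegral.continuousOn_primitive_interval' hψ₀i
        (by rw [Set.uIcc_of_le hle]; constructor <;> linarith :
          (0 : ℝ) ∈ Set.uIcc (-Real.pi) Real.pi)
      rw [Set.uIcc_of_le hle] at hcont
      obtain ⟨B, hB⟩ := isCompact_Icc.exists_bound_of_continuousOn hcont
      exact ⟨B, fun s hs => hB s (abs_le.1 hs)⟩
    rw [Metric.tendsto_nhds]
    intro η hη
    -- As `r → 1` only `2πε` survives in the bound, and this choice makes it `η / 2`.
    set ε : ℝ := η / (4 * Real.pi) with hε
    have hε0 : 0 < ε := by positivity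
    have hder : ∀ᶠ s in 𝓝 (0 : ℝ), |(∫ x in (0 : ℝ)..s, ψ x) - c * s| ≤ ε * |s| := by
      have := (hasDerivAt_iff_isLittleO.1 hc).def hε0
      simpa [mul_comm c] using this
    obtain ⟨δ', hδ', hball⟩ := Metric.eventually_nhds_iff.1 hder
    set δ : ℝ := min (δ' / 2) 1 with hδ
    have hδ0 : 0 < δ := by positivity
    have hδπ : δ < Real.pi := (min_le_right _ _).trans_lt (by linarith [Real.pi_gt_three])
    have hsmall : ∀ s, |s| ≤ δ → |∫ x in (0 : ℝ)..s, ψ₀ x| ≤ ε * |s| := fun s hs => by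
      rw [hprim s (hs.trans hδπ.le)]
      refine hball ?_
      rw [Real.dist_eq, sub_zero]
      exact (hs.trans (min_le_left _ _)).trans_lt (by linarith)
    have hrem : Tendsto (fun r : ℝ => 2 * B * ((1 - r ^ 2) / (1 + r) ^ 2)
        + (ε * (2 * Real.pi) + 2 * Real.pi * (2 * (1 - r ^ 2) / Real.sin δ ^ 4 * B)))
        (𝓝[<] 1) (𝓝 (ε * (2 * Real.pi))) := by
      have hca : ContinuousAt (fun r : ℝ => 2 * B * ((1 - r ^ 2) / (1 + r) ^ 2)
        + (ε * (2 * Real.pi) + 2 * Real.pi * (2 * (1 - r ^ 2) / Real.sin δ ^ 4 * B))) 1 := by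
        refine ContinuousAt.add (ContinuousAt.mul continuousAt_const
          (ContinuousAt.div (by fun_prop) (by fun_prop) (by norm_num))) (by fun_prop)
      have := hca.tendsto.mono_left (nhdsWithin_le_nhds (s := Set.Iio 1))
      simpa using this
    have hlt : ε * (2 * Real.pi) < η := by
      rw [hε]; field_simp; linarith
    filter_upwards [hrem.eventually_lt_const hlt, Ioo_mem_nhdsLT (zero_lt_one' ℝ)] with r hr hr01
    rw [Real.dist_eq, sub_zero]
    exact (abs_integral_polarPoisson_mul_le hψ₀i hr01.1.le hr01.2 hδ0 hδπ hε0.le hsmall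
      hB).trans_lt hr
  have hfin : Tendsto (fun r => (2 * Real.pi)⁻¹ *
      (∫ s in (-Real.pi)..Real.pi, polarPoisson r s * ψ₀ s) + c) (𝓝[<] 1) (𝓝 c) := by
    simpa using (hlim0.const_mul (2 * Real.pi)⁻¹).add_const c
  refine hfin.congr' ?_
  filter_upwards [Ioo_mem_nhdsLT (zero_lt_one' ℝ)] with r hr
  have hPc := continuous_polarPoisson hr.1.le hr.2
  have : ∫ s in (-Real.pi)..Real.pi, polarPoisson r s * ψ₀ s
      = (∫ s in (-Real.pi)..Real.pi, polarPoisson r s * ψ s) - 2 * Real.pi * c := by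
    simp only [hψ₀, mul_sub]
    rw [intervalIntegral.integral_sub (hψ.continuousOn_mul hPc.continuousOn)
      ((hPc.intervalIntegrable _ _).mul_const c), intervalIntegral.integral_mul_const,
      integral_polarPoisson hr.1.le hr.2]
  rw [this]
  field_simp
  ring

end PoissonKernel

end

noncomputable section

/-! ### Abel summation of orthogonal series. -/

section HilbertSpace

variable {E : Type*} [NormedAddCommGroup E] [InnerProductSpace ℂ E]

theorem Orthonormal.hasSum_norm_sq {v : ℕ → E} (hv : Orthonormal ℂ v) {c : ℕ → ℂ} {x : E}
    (hx : HasSum (fun n => c n • v n) x) : HasSum (fun n => ‖c n‖ ^ 2) (‖x‖ ^ 2) := by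
  have hs : ∀ s : Finset ℕ, ‖∑ n ∈ s, c n • v n‖ ^ 2 = ∑ n ∈ s, ‖c n‖ ^ 2 := fun s => by
    have h := hv.inner_sum c c s
    rw [inner_self_eq_norm_sq_to_K] at h
    simp only [Complex.conj_mul'] at h
    apply Complex.ofReal_injective
    simpa using h
  have h : Tendsto (fun s : Finset ℕ => ‖∑ n ∈ s, c n • v n‖ ^ 2) atTop (𝓝 (‖x‖ ^ 2)) :=
    Tendsto.pow (Tendsto.norm hx) 2
  simp only [hs] at h
  exact h

/-- Abel means with bounded norms of an orthogonal series converge. -/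
theorem Orthonormal.exists_tendsto_abel [CompleteSpace E] {v : ℕ → E} (hv : Orthonormal ℂ v)
    {a : ℕ → ℂ} {U : ℝ → E} {M : ℝ}
    (hU : ∀ r : ℝ, 0 ≤ r → r < 1 → HasSum (fun n => (a n * (r : ℂ) ^ n) • v n) (U r))
    (hM : ∀ r, 0 ≤ r → r < 1 → ‖U r‖ ^ 2 ≤ M) :
    ∃ φ, Tendsto U (𝓝[<] 1) (𝓝 φ) := by
  have hev : ∀ᶠ r : ℝ in 𝓝[<] 1, r ∈ Set.Ioo (0 : ℝ) 1 := Ioo_mem_nhdsLT zero_lt_one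
  have hpow : ∀ n, Tendsto (fun r : ℝ => a n * (r : ℂ) ^ n) (𝓝[<] 1) (𝓝 (a n)) := fun n => by
    have : Continuous fun r : ℝ => a n * (r : ℂ) ^ n := by fun_prop
    simpa using (this.tendsto 1).mono_left nhdsWithin_le_nhds
  -- Each finite sum of `|a n|² r^(2n)` is at most `M`; letting `r → 1` in it gives square
  -- summability.
  have hsum : Summable fun n => ‖a n‖ ^ 2 := by
    refine summable_of_sum_le (fun n => by positivity) (c := M) fun s => ?_
    refine le_of_tendsto (f := fun r : ℝ => ∑ n ∈ s, ‖a n * (r : ℂ) ^ n‖ ^ 2)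
      (tendsto_finsetSum s fun n _ => (hpow n).norm.pow 2) ?_
    filter_upwards [hev] with r hr
    have h := hv.hasSum_norm_sq (hU r hr.1.le hr.2)
    exact (sum_le_hasSum s (fun n _ => by positivity) h).trans (hM r hr.1.le hr.2)
  have hφ : Summable fun n => a n • v n := by
    have := hv.orthogonalFamily.summable_iff_norm_sq_summable (f := a)
    simpa using this.2 hsum
  refine ⟨∑' n, a n • v n, ?_⟩
  rw [tendsto_iff_norm_sub_tendsto_zero]
  -- By Parseval the error is `∑ |a n|² |r^n - 1|²`, which is dominated by `∑ |a n|²`.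
  have hdiff : ∀ r ∈ Set.Ioo (0 : ℝ) 1,
      ‖U r - ∑' n, a n • v n‖ ^ 2 = ∑' n, ‖a n * (r : ℂ) ^ n - a n‖ ^ 2 := fun r hr => by
    have h := (hU r hr.1.le hr.2).sub hφ.hasSum
    simp only [← sub_smul] at h
    exact (hv.hasSum_norm_sq h).tsum_eq.symm
  have hlim : Tendsto (fun r : ℝ => ∑' n, ‖a n * (r : ℂ) ^ n - a n‖ ^ 2) (𝓝[<] 1)
      (𝓝 (∑' _ : ℕ, (0 : ℝ))) := by
    refine tendsto_tsum_of_dominated_convergence hsum (fun n => ?_) ?_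
    · simpa using ((hpow n).sub_const (a n)).norm.pow 2
    · filter_upwards [hev] with r hr n
      have h1 : r ^ n ≤ 1 := pow_le_one₀ hr.1.le hr.2.le
      have h0 : 0 ≤ r ^ n := pow_nonneg hr.1.le n
      have h2 : ‖(r : ℂ) ^ n - 1‖ ≤ 1 := by
        rw [← Complex.ofReal_pow, ← Complex.ofReal_one, ← Complex.ofReal_sub, Complex.norm_real,
          Real.norm_eq_abs, abs_le]
        constructor <;> linarith
      rw [norm_pow, norm_norm]
      refine pow_le_pow_left₀ (norm_nonneg _) ?_ 2
      rw [show a n * (r : ℂ) ^ n - a n = a n * ((r : ℂ) ^ n - 1) by ring, norm_mul]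
      exact mul_le_of_le_one_right (norm_nonneg _) h2
  rw [tsum_zero] at hlim
  have hsq : Tendsto (fun r => ‖U r - ∑' n, a n • v n‖ ^ 2) (𝓝[<] 1) (𝓝 0) := by
    refine hlim.congr' ?_
    filter_upwards [hev] with r hr using (hdiff r hr).symm
  simpa using (hsq.sqrt).congr fun r => Real.sqrt_sq (norm_nonneg _)

end HilbertSpace

/-! ### `L²` boundary functions, Poisson representation and radial limits. -/

section Boundary

open AddCircle

instance fact_two_pi_pos : Fact (0 < 2 * Real.pi) := ⟨Real.two_pi_pos⟩

/-- The space `L²` of the unit circle, parametrized by the angle. -/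
abbrev CircleL2 : Type := Lp ℂ 2 (haarAddCircle : Measure (AddCircle (2 * Real.pi)))

theorem coe_toCircle_two_pi (x : ℝ) :
    ((toCircle (x : AddCircle (2 * Real.pi)) : Circle) : ℂ) = Complex.exp (x * Complex.I) := by
  rw [toCircle_apply_mk, div_self Real.two_pi_pos.ne', one_mul, Circle.coe_exp]

theorem integral_haarAddCircle_eq_intervalIntegral {E : Type*} [NormedAddCommGroup E]
    [NormedSpace ℝ E] (F : AddCircle (2 * Real.pi) → E) (t : ℝ) :
    ∫ θ, F θ ∂haarAddCircle
      = (2 * Real.pi)⁻¹ • ∫ θ in t..(t + 2 * Real.pi), F (θ : AddCircle (2 * Real.pi)) := by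
  rw [integral_haarAddCircle, AddCircle.intervalIntegral_preimage]

open Classical in
/-- The function `h (r ·)` on the unit circle, as an element of `L²`. -/
def dilationLp (h : ℂ → ℂ) (r : ℝ) : CircleL2 :=
  if hm : MemLp (fun θ : AddCircle (2 * Real.pi) => h (r * (toCircle θ : ℂ))) 2 haarAddCircle
  then hm.toLp else 0

theorem norm_mul_toCircle_lt {r : ℝ} (h0 : 0 ≤ r) (h1 : r < 1) (θ : AddCircle (2 * Real.pi)) :
    ‖(r : ℂ) * (toCircle θ : ℂ)‖ < 1 := by
  rw [norm_mul, Circle.norm_coe, mul_one, Complex.norm_real, Real.norm_of_nonneg h0]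
  exact h1

theorem continuous_dilation {h : ℂ → ℂ} (hh : ContinuousOn h (Metric.ball 0 1)) {r : ℝ}
    (h0 : 0 ≤ r) (h1 : r < 1) :
    Continuous fun θ : AddCircle (2 * Real.pi) => h (r * (toCircle θ : ℂ)) :=
  hh.comp_continuous (continuous_const.mul (continuous_subtype_val.comp continuous_toCircle))
    fun θ => by simpa using norm_mul_toCircle_lt h0 h1 θ

/-- For `0 ≤ r < 1` the dilation is continuous on the compact circle, so the default value `0` plays
no role. -/
theorem dilationLp_eq {h : ℂ → ℂ} (hh : ContinuousOn h (Metric.ball 0 1)) {r : ℝ}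
    (h0 : 0 ≤ r) (h1 : r < 1) :
    dilationLp h r = ContinuousMap.toLp 2 haarAddCircle ℂ ⟨_, continuous_dilation hh h0 h1⟩ := by
  set c : C(AddCircle (2 * Real.pi), ℂ) := ⟨_, continuous_dilation hh h0 h1⟩
  have hae := ContinuousMap.coeFn_toLp (p := 2) (𝕜 := ℂ) haarAddCircle c
  have hm : MemLp (fun θ : AddCircle (2 * Real.pi) => h (r * (toCircle θ : ℂ))) 2
      haarAddCircle := (Lp.memLp (ContinuousMap.toLp 2 haarAddCircle ℂ c)).ae_eq hae
  rw [dilationLp, dif_pos hm]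
  exact Lp.ext (hm.coeFn_toLp.trans hae.symm)

theorem coeFn_dilationLp {h : ℂ → ℂ} (hh : ContinuousOn h (Metric.ball 0 1)) {r : ℝ}
    (h0 : 0 ≤ r) (h1 : r < 1) :
    dilationLp h r =ᵐ[haarAddCircle] fun θ => h (r * (toCircle θ : ℂ)) := by
  rw [dilationLp_eq hh h0 h1]
  exact ContinuousMap.coeFn_toLp _ _

/-- The series converges absolutely in the uniform norm, and evaluation at points identifies its
sum. The uniform statement is then carried to `L²` by the continuous inclusion. -/
theorem hasSum_dilation_fourier {h : ℂ → ℂ} {a : ℕ → ℂ}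
    (ha : ∀ z : ℂ, ‖z‖ < 1 → HasSum (fun n => a n * z ^ n) (h z)) {r : ℝ}
    (h0 : 0 ≤ r) (h1 : r < 1) (c : C(AddCircle (2 * Real.pi), ℂ))
    (hc : ∀ θ, c θ = h (r * (toCircle θ : ℂ))) :
    HasSum (fun n : ℕ => (a n * (r : ℂ) ^ n) • fourier (T := 2 * Real.pi) (n : ℤ)) c := by
  have hr : ‖(r : ℂ)‖ < 1 := by rwa [Complex.norm_real, Real.norm_of_nonneg h0]
  have hS : Summable fun n : ℕ => (a n * (r : ℂ) ^ n) • fourier (T := 2 * Real.pi) (n : ℤ) := by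
    refine Summable.of_norm ?_
    simp only [norm_smul, fourier_norm, mul_one]
    exact (ha r hr).summable.norm
  have heq : c = ∑' n : ℕ, (a n * (r : ℂ) ^ n) • fourier (T := 2 * Real.pi) (n : ℤ) := by
    ext θ
    have h2 := (ContinuousMap.evalCLM ℂ θ).hasSum hS.hasSum
    have h3 := ha _ (norm_mul_toCircle_lt h0 h1 θ)
    have he : (fun n : ℕ => a n * ((r : ℂ) * (toCircle θ : ℂ)) ^ n) = fun n : ℕ =>
        ContinuousMap.evalCLM ℂ θ
          ((a n * (r : ℂ) ^ n) • fourier (T := 2 * Real.pi) (n : ℤ)) := by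
      funext n
      simp [fourier_apply, toCircle_nsmul, mul_pow, mul_assoc]
    rw [he] at h3
    rw [hc θ]
    exact h3.unique h2
  rw [heq]
  exact hS.hasSum

theorem hasSum_dilationLp {h : ℂ → ℂ} (hh : ContinuousOn h (Metric.ball 0 1)) {a : ℕ → ℂ}
    (ha : ∀ z : ℂ, ‖z‖ < 1 → HasSum (fun n => a n * z ^ n) (h z)) {r : ℝ}
    (h0 : 0 ≤ r) (h1 : r < 1) :
    HasSum (fun n : ℕ => (a n * (r : ℂ) ^ n) • fourierLp (T := 2 * Real.pi) 2 (n : ℤ))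
      (dilationLp h r) := by
  rw [dilationLp_eq hh h0 h1]
  have hc := hasSum_dilation_fourier ha h0 h1 ⟨_, continuous_dilation hh h0 h1⟩ fun _ => rfl
  have hL := ContinuousLinearMap.hasSum
    (ContinuousMap.toLp (E := ℂ) 2 (haarAddCircle (T := 2 * Real.pi)) ℂ) hc
  simp only [map_smul] at hL
  exact hL

theorem norm_sq_Lp_two_eq_integral (u : CircleL2) :
    ‖u‖ ^ 2 = ∫ θ, ‖u θ‖ ^ 2 ∂haarAddCircle := by
  have h := congrArg RCLike.re (L2.inner_def (𝕜 := ℂ) u u)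
  rw [← integral_re (L2.integrable_inner u u)] at h
  simpa only [← norm_sq_eq_re_inner] using h

theorem exists_tendsto_dilationLp {h : ℂ → ℂ} (hh : DifferentiableOn ℂ h (Metric.ball 0 1))
    {M : ℝ} (hM : ∀ r, 0 ≤ r → r < 1 → ‖dilationLp h r‖ ^ 2 ≤ M) :
    ∃ φ, Tendsto (dilationLp h) (𝓝[<] 1) (𝓝 φ) := by
  obtain ⟨a, ha⟩ := exists_hasSum_coeff_mul_pow hh
  refine Orthonormal.exists_tendsto_abel
    (orthonormal_fourier.comp (fun n : ℕ => (n : ℤ)) Nat.cast_injective) (a := a) (M := M)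
    (fun r h0 h1 => ?_) hM
  exact hasSum_dilationLp hh.continuousOn ha h0 h1

/-- The Poisson integral representation by the boundary function in `L²`. -/
theorem eq_integral_poissonKernel_mul {h : ℂ → ℂ}
    (hh : DifferentiableOn ℂ h (Metric.ball 0 1))
    {φ : CircleL2}
    (hφ : Tendsto (dilationLp h) (𝓝[<] 1) (𝓝 φ)) {w : ℂ} (hw : ‖w‖ < 1) :
    h w = ∫ θ, (poissonKernel 0 w (toCircle θ) : ℂ) * φ θ ∂haarAddCircle := by
  have hw' : w ∈ Metric.ball (0 : ℂ) 1 := by simpa using hw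
  have hKc : Continuous fun θ : AddCircle (2 * Real.pi) =>
      (poissonKernel 0 w (toCircle θ) : ℂ) := by
    have hc : Continuous fun θ : AddCircle (2 * Real.pi) => (toCircle θ : ℂ) :=
      continuous_subtype_val.comp continuous_toCircle
    refine Complex.continuous_ofReal.comp ?_
    simp only [poissonKernel_def, sub_zero]
    refine Continuous.div (by fun_prop) (by fun_prop) fun θ => ?_
    have : (toCircle θ : ℂ) - w ≠ 0 := by
      intro h0
      have h2 : ‖(toCircle θ : ℂ)‖ = ‖w‖ := by rw [sub_eq_zero.1 h0]
      rw [Circle.norm_coe] at h2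
      linarith
    simpa using this
  set K : C(AddCircle (2 * Real.pi), ℂ) := ⟨_, hKc⟩ with hK
  -- For fixed `w` the kernel lies in `L²`, so pairing with it is continuous and Poisson's formula
  -- for `h(r ·)` survives the limit `r → 1`.
  set k := ContinuousMap.toLp (E := ℂ) 2 haarAddCircle ℂ K with hk
  have hkae : k =ᵐ[haarAddCircle] fun θ => (poissonKernel 0 w (toCircle θ) : ℂ) :=
    ContinuousMap.coeFn_toLp _ K
  set B := ContinuousLinearMap.mul ℂ ℂ with hB
  have hpair : ∀ u : CircleL2,
      B.lpPairing haarAddCircle 2 2 k u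
        = ∫ θ, (poissonKernel 0 w (toCircle θ) : ℂ) * u θ ∂haarAddCircle := fun u => by
    rw [ContinuousLinearMap.lpPairing_eq_integral]
    refine integral_congr_ae ?_
    filter_upwards [hkae] with θ hθ
    simp [hB, hθ]
  have hlim : Tendsto (fun r => B.lpPairing haarAddCircle 2 2 k (dilationLp h r)) (𝓝[<] 1)
      (𝓝 (B.lpPairing haarAddCircle 2 2 k φ)) :=
    ((B.lpPairing haarAddCircle 2 2 k).continuous.tendsto φ).comp hφ
  have hlim2 : Tendsto (fun r : ℝ => h (r * w)) (𝓝[<] 1) (𝓝 (h w)) := by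
    have hc : ContinuousAt h w := (hh.differentiableAt (Metric.isOpen_ball.mem_nhds hw')).continuousAt
    have ht : Tendsto (fun r : ℝ => (r : ℂ) * w) (𝓝[<] 1) (𝓝 w) := by
      have : Continuous fun r : ℝ => (r : ℂ) * w := by fun_prop
      simpa using (this.tendsto 1).mono_left nhdsWithin_le_nhds
    exact hc.tendsto.comp ht
  rw [← hpair]
  refine tendsto_nhds_unique hlim2 (hlim.congr' ?_)
  filter_upwards [Ioo_mem_nhdsLT (zero_lt_one' ℝ)] with r hr
  have hd : DiffContOnCl ℂ (fun z => h (r * z)) (Metric.ball 0 1) := by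
    refine DifferentiableOn.diffContOnCl ?_
    rw [closure_ball (0 : ℂ) one_ne_zero]
    refine hh.comp (by fun_prop) fun z hz => ?_
    rw [mem_closedBall_zero_iff] at hz
    rw [mem_ball_zero_iff, norm_mul, Complex.norm_real, Real.norm_of_nonneg hr.1.le]
    nlinarith [hr.1, hr.2, norm_nonneg z]
  rw [hpair, ← hd.circleAverage_poissonKernel_smul hw', Real.circleAverage_def]
  rw [integral_congr_ae (g := fun θ : AddCircle (2 * Real.pi) =>
    (poissonKernel 0 w (toCircle θ) : ℂ) * h (r * (toCircle θ : ℂ)))]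
  · rw [integral_haarAddCircle_eq_intervalIntegral _ 0, zero_add]
    simp only [coe_toCircle_two_pi, Pi.smul_apply', circleMap_zero, Complex.ofReal_one, one_mul,
      Complex.real_smul]
  · filter_upwards [coeFn_dilationLp hh.continuousOn hr.1.le hr.2] with θ hθ
    rw [hθ]

theorem intervalIntegrable_Lp_comp_coe
    (φ : CircleL2) (a b : ℝ) :
    IntervalIntegrable (fun x : ℝ => φ (x : AddCircle (2 * Real.pi))) volume a b := by
  have hper : Function.Periodic (fun x : ℝ => φ (x : AddCircle (2 * Real.pi))) (2 * Real.pi) :=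
    fun x => by simp
  refine hper.intervalIntegrable (t := 0) Real.two_pi_pos.ne' ?_ a b
  have hint : Integrable φ volume :=
    ((Lp.memLp φ).of_haarAddCircle).integrable (by norm_num)
  rw [intervalIntegrable_iff_integrableOn_Ioc_of_le (by linarith [Real.pi_pos])]
  exact (AddCircle.measurePreserving_mk (2 * Real.pi) 0).integrable_comp_of_integrable hint

/-- **Fatou's theorem**: radial limits exist almost everywhere and agree with the boundary
function. -/
theorem ae_hasRadialLimit {h : ℂ → ℂ} (hh : DifferentiableOn ℂ h (Metric.ball 0 1))
    {φ : CircleL2}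
    (hφ : Tendsto (dilationLp h) (𝓝[<] 1) (𝓝 φ)) :
    ∀ᵐ θ : ℝ, HasRadialLimit h θ (φ (θ : AddCircle (2 * Real.pi))) := by
  set ψ : ℝ → ℂ := fun x => φ (x : AddCircle (2 * Real.pi)) with hψ
  have hii : ∀ a b, IntervalIntegrable ψ volume a b := intervalIntegrable_Lp_comp_coe φ
  have hrep : ∀ θ r : ℝ, 0 ≤ r → r < 1 → h (r * Complex.exp (θ * Complex.I))
      = (2 * Real.pi)⁻¹ • ∫ s in (-Real.pi)..Real.pi, polarPoisson r s • ψ (θ + s) := by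
    intro θ r h0 h1
    have hw : ‖(r : ℂ) * Complex.exp (θ * Complex.I)‖ < 1 := by
      rwa [norm_mul, Complex.norm_exp_ofReal_mul_I, mul_one, Complex.norm_real,
        Real.norm_of_nonneg h0]
    rw [eq_integral_poissonKernel_mul hh hφ hw,
      integral_haarAddCircle_eq_intervalIntegral _ (θ + -Real.pi),
      show θ + -Real.pi + 2 * Real.pi = θ + Real.pi by ring,
      ← intervalIntegral.integral_comp_add_left]
    congr 2 with s
    rw [coe_toCircle_two_pi, Complex.real_smul, ← poissonKernel_circleMap_add θ s, circleMap_zero,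
      Complex.ofReal_one, one_mul]
  -- The pointwise Fatou theorem is for real densities; it is applied to the real and imaginary
  -- parts.
  have key : ∀ L : ℂ →L[ℝ] ℝ, ∀ᵐ θ : ℝ,
      Tendsto (fun r : ℝ => L (h (r * Complex.exp (θ * Complex.I)))) (𝓝[<] 1) (𝓝 (L (ψ θ))) := by
    intro L
    have hLi : ∀ a b, IntervalIntegrable (fun x => L (ψ x)) volume a b := fun a b =>
      ⟨L.integrable_comp (hii a b).1, L.integrable_comp (hii a b).2⟩
    have hloc : LocallyIntegrable (fun x => L (ψ x)) volume := by
      rw [locallyIntegrable_iff]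
      intro k hk
      obtain ⟨R, hR⟩ := hk.isBounded.subset_closedBall 0
      refine IntegrableOn.mono_set ?_ hR
      rw [Real.closedBall_eq_Icc, integrableOn_Icc_iff_integrableOn_Ioc]
      exact (hLi _ _).1
    -- Lebesgue differentiation supplies the derivative hypothesis at almost every `θ`, after which
    -- `θ` is translated to `0`.
    filter_upwards [LocallyIntegrable.ae_hasDerivAt_integral hloc] with θ hθ
    have hder : HasDerivAt (fun s => ∫ x in (0 : ℝ)..s, L (ψ (θ + x))) (L (ψ θ)) 0 := by
      have h1 := HasDerivAt.comp_const_add θ (0 : ℝ) (by simpa using hθ θ)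
      refine h1.congr_of_eventuallyEq (Eventually.of_forall fun s => ?_)
      simpa using intervalIntegral.integral_comp_add_left (a := 0) (b := s)
        (fun x => L (ψ x)) θ
    have hint : IntervalIntegrable (fun s => L (ψ (θ + s))) volume (-Real.pi) Real.pi := by
      simpa using (hLi (θ + -Real.pi) (θ + Real.pi)).comp_add_left (c := θ) enorm_ne_top
    refine (tendsto_integral_polarPoisson_mul hint hder).congr' ?_
    filter_upwards [Ioo_mem_nhdsLT (zero_lt_one' ℝ)] with r hr
    have hψi : IntervalIntegrable (fun s => ψ (θ + s)) volume (-Real.pi) Real.pi := by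
      simpa using (hii (θ + -Real.pi) (θ + Real.pi)).comp_add_left (c := θ) enorm_ne_top
    rw [hrep θ r hr.1.le hr.2, L.map_smul, ← L.intervalIntegral_comp_comm
      (hψi.continuousOn_smul (continuous_polarPoisson hr.1.le hr.2).continuousOn)]
    simp only [map_smul, smul_eq_mul]
  filter_upwards [key Complex.reCLM, key Complex.imCLM] with θ hre him
  have h1 := (Complex.continuous_ofReal.tendsto _).comp hre
  have h2 := ((Complex.continuous_ofReal.tendsto _).comp him).mul_const Complex.I
  have h3 := h1.add h2
  simp only [Complex.reCLM_apply, Complex.imCLM_apply, Complex.re_add_im] at h3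
  refine h3.congr fun r => ?_
  simp [Complex.re_add_im]

end Boundary

end

noncomputable section

/-! ### Products of two `L²` functions on the circle. -/

section CircleProducts

open AddCircle

/-- Because of the conjugate on `b`, the cross term involves `a * b` itself, hence an analytic
function when `a` and `b` are values of analytic functions. -/
theorem norm_add_conj_sq (a b : ℂ) :
    ‖a + (starRingEnd ℂ) b‖ ^ 2 = ‖a‖ ^ 2 + ‖b‖ ^ 2 + 2 * (a * b).re := by
  simp only [← Complex.normSq_eq_norm_sq, Complex.normSq_apply, Complex.add_re, Complex.add_im,
    Complex.conj_re, Complex.conj_im, Complex.mul_re]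
  ring

theorem integrable_norm_sq_circleL2 (u : CircleL2) :
    Integrable (fun θ => ‖u θ‖ ^ 2) haarAddCircle :=
  (Lp.memLp u).integrable_norm_pow two_ne_zero

theorem integrable_mul_circleL2 (u v : CircleL2) :
    Integrable (fun θ => u θ * v θ) haarAddCircle :=
  (Lp.memLp u).integrable_mul (Lp.memLp v)

theorem integral_norm_add_conj_sq (u v : CircleL2) :
    ∫ θ, ‖u θ + (starRingEnd ℂ) (v θ)‖ ^ 2 ∂haarAddCircle
      = ‖u‖ ^ 2 + ‖v‖ ^ 2 + 2 * (∫ θ, u θ * v θ ∂haarAddCircle).re := by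
  simp only [norm_add_conj_sq]
  have hre : Integrable (fun θ => (u θ * v θ).re) haarAddCircle :=
    Complex.reCLM.integrable_comp (integrable_mul_circleL2 u v)
  have hsq : Integrable (fun θ => ‖u θ‖ ^ 2 + ‖v θ‖ ^ 2) haarAddCircle :=
    (integrable_norm_sq_circleL2 u).add (integrable_norm_sq_circleL2 v)
  rw [integral_add hsq
    (hre.const_mul 2), integral_add (integrable_norm_sq_circleL2 u)
    (integrable_norm_sq_circleL2 v), integral_const_mul, norm_sq_Lp_two_eq_integral,
    norm_sq_Lp_two_eq_integral]
  congr 2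
  exact integral_re (integrable_mul_circleL2 u v)

theorem integral_norm_mul_le (u v : CircleL2) :
    ∫ θ, ‖u θ * v θ‖ ∂haarAddCircle ≤ 1 / 2 * (‖u‖ ^ 2 + ‖v‖ ^ 2) := by
  rw [norm_sq_Lp_two_eq_integral, norm_sq_Lp_two_eq_integral,
    ← integral_add (integrable_norm_sq_circleL2 u) (integrable_norm_sq_circleL2 v),
    ← integral_const_mul]
  refine integral_mono (integrable_mul_circleL2 u v).norm
    (((integrable_norm_sq_circleL2 u).add (integrable_norm_sq_circleL2 v)).const_mul _)
    fun θ => ?_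
  simp only [norm_mul]
  nlinarith [sq_nonneg (‖u θ‖ - ‖v θ‖)]

theorem continuous_integral_mul_circleL2 :
    Continuous fun p : CircleL2 × CircleL2 => ∫ θ, p.1 θ * p.2 θ ∂haarAddCircle := by
  have h : Continuous fun p : CircleL2 × CircleL2 =>
      (ContinuousLinearMap.mul ℂ ℂ).lpPairing haarAddCircle 2 2 p.1 p.2 := by fun_prop
  simpa only [ContinuousLinearMap.lpPairing_eq_integral, ContinuousLinearMap.mul_apply'] using h

/-- This is the `L¹` norm of the Hölder product, a continuous bilinear map. It carries the `hg` term
to the boundary. -/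
theorem continuous_integral_norm_mul_circleL2 :
    Continuous fun p : CircleL2 × CircleL2 => ∫ θ, ‖p.1 θ * p.2 θ‖ ∂haarAddCircle := by
  have h : Continuous fun p : CircleL2 × CircleL2 =>
      ‖(ContinuousLinearMap.mul ℂ ℂ).holderL haarAddCircle 2 2 1 p.1 p.2‖ := by fun_prop
  refine h.congr fun p => ?_
  rw [L1.norm_eq_integral_norm, ContinuousLinearMap.holderL_apply_apply]
  refine integral_congr_ae ?_
  filter_upwards [(ContinuousLinearMap.mul ℂ ℂ).coeFn_holder (r := 1) p.1 p.2] with θ hθ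
  rw [hθ, ContinuousLinearMap.mul_apply']

end CircleProducts

/-! ### The estimate on disks of radius less than one. -/

section Dilations

open AddCircle

theorem norm_sq_dilationLp {h : ℂ → ℂ} (hh : ContinuousOn h (Metric.ball 0 1)) {r : ℝ}
    (h0 : 0 ≤ r) (h1 : r < 1) (t : ℝ) :
    ‖dilationLp h r‖ ^ 2 = (2 * Real.pi)⁻¹ *
      ∫ θ in t..(t + 2 * Real.pi), ‖h (r * Complex.exp (θ * Complex.I))‖ ^ 2 := by
  rw [norm_sq_Lp_two_eq_integral, integral_congr_ae
    (g := fun θ => ‖h (r * (toCircle θ : ℂ))‖ ^ 2)]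
  · rw [integral_haarAddCircle_eq_intervalIntegral _ t, smul_eq_mul]
    simp only [coe_toCircle_two_pi]
  · filter_upwards [coeFn_dilationLp hh h0 h1] with θ hθ
    rw [hθ]

theorem integral_norm_mul_dilationLp {h g : ℂ → ℂ} (hh : ContinuousOn h (Metric.ball 0 1))
    (hg : ContinuousOn g (Metric.ball 0 1)) {r : ℝ} (h0 : 0 ≤ r) (h1 : r < 1) (t : ℝ) :
    ∫ θ, ‖dilationLp h r θ * dilationLp g r θ‖ ∂haarAddCircle = (2 * Real.pi)⁻¹ *
      ∫ θ in t..(t + 2 * Real.pi),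
        ‖h (r * Complex.exp (θ * Complex.I)) * g (r * Complex.exp (θ * Complex.I))‖ := by
  rw [integral_congr_ae
    (g := fun θ => ‖h (r * (toCircle θ : ℂ)) * g (r * (toCircle θ : ℂ))‖)]
  · rw [integral_haarAddCircle_eq_intervalIntegral _ t, smul_eq_mul]
    simp only [coe_toCircle_two_pi]
  · filter_upwards [coeFn_dilationLp hh h0 h1, coeFn_dilationLp hg h0 h1] with θ hθ hθ'
    rw [hθ, hθ']

/-- Mean value property of `hg`, which vanishes at the origin; this is where the normalization of
`g` enters. -/
theorem integral_mul_dilationLp_eq_zero {h g : ℂ → ℂ}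
    (hh : DifferentiableOn ℂ h (Metric.ball 0 1)) (hg : DifferentiableOn ℂ g (Metric.ball 0 1))
    (hg0 : g 0 = 0) {r : ℝ} (h0 : 0 ≤ r) (h1 : r < 1) :
    ∫ θ, dilationLp h r θ * dilationLp g r θ ∂haarAddCircle = 0 := by
  rw [integral_congr_ae (g := fun θ => h (r * (toCircle θ : ℂ)) * g (r * (toCircle θ : ℂ)))]
  · rw [integral_haarAddCircle_eq_intervalIntegral _ 0, zero_add]
    simp only [coe_toCircle_two_pi]
    have hd : DiffContOnCl ℂ (fun z => h z * g z) (Metric.ball 0 |r|) := by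
      refine DifferentiableOn.diffContOnCl ((hh.mul hg).mono ?_)
      refine Metric.closure_ball_subset_closedBall.trans
        (Metric.closedBall_subset_ball ?_)
      rwa [abs_of_nonneg h0]
    have h := hd.circleAverage
    rw [Real.circleAverage_def, hg0, mul_zero] at h
    simpa only [circleMap_zero] using h
  · filter_upwards [coeFn_dilationLp hh.continuousOn h0 h1,
      coeFn_dilationLp hg.continuousOn h0 h1] with θ hθ hθ'
    rw [hθ, hθ']

/-- The Fejér–Riesz type estimate for `h + conj g` on a disk of radius `ρ < 1`. -/
theorem integral_norm_sq_add_conj_diameter_le {h g : ℂ → ℂ}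
    (hh : DifferentiableOn ℂ h (Metric.ball 0 1)) (hg : DifferentiableOn ℂ g (Metric.ball 0 1))
    {ρ : ℝ} (h0 : 0 < ρ) (h1 : ρ < 1) (t : ℝ) :
    ∫ x in (-ρ)..ρ, ‖h (x * Complex.exp (t * Complex.I))
        + (starRingEnd ℂ) (g (x * Complex.exp (t * Complex.I)))‖ ^ 2
      ≤ ρ * (Real.pi * (‖dilationLp h ρ‖ ^ 2 + ‖dilationLp g ρ‖ ^ 2)
        + 2 * Real.pi * ∫ θ, ‖dilationLp h ρ θ * dilationLp g ρ θ‖ ∂haarAddCircle) := by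
  set c : ℂ := Complex.exp (t * Complex.I) with hc
  have hcn : ‖c‖ = 1 := Complex.norm_exp_ofReal_mul_I t
  have hρ : 1 < ρ⁻¹ := (one_lt_inv₀ h0).2 h1
  have hmaps : Set.MapsTo (fun z : ℂ => (ρ : ℂ) * (c * z)) (Metric.ball 0 ρ⁻¹)
      (Metric.ball 0 1) := fun z hz => by
    rw [mem_ball_zero_iff] at hz ⊢
    rw [norm_mul, norm_mul, hcn, one_mul, Complex.norm_real, Real.norm_of_nonneg h0.le]
    calc ρ * ‖z‖ < ρ * ρ⁻¹ := mul_lt_mul_of_pos_left hz h0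
      _ = 1 := mul_inv_cancel₀ h0.ne'
  have hHd : DifferentiableOn ℂ (fun z : ℂ => h (ρ * (c * z))) (Metric.ball 0 ρ⁻¹) :=
    hh.comp (by fun_prop) hmaps
  have hGd : DifferentiableOn ℂ (fun z : ℂ => g (ρ * (c * z))) (Metric.ball 0 ρ⁻¹) :=
    hg.comp (by fun_prop) hmaps
  have e1 := integral_norm_sq_diameter_le hρ hHd
  have e2 := integral_norm_sq_diameter_le hρ hGd
  have e3 := integral_norm_diameter_le hρ (hHd.mul hGd)
  -- Turning the diameter to the real axis merely shifts the angular interval by `t`.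
  have hrot : ∀ G : ℂ → ℝ, ∫ θ in (0 : ℝ)..(2 * Real.pi),
      G (ρ * (c * Complex.exp (θ * Complex.I)))
      = ∫ θ in t..(t + 2 * Real.pi), G (ρ * Complex.exp (θ * Complex.I)) := fun G => by
    have h2 := intervalIntegral.integral_comp_add_left (a := 0) (b := 2 * Real.pi)
      (fun θ : ℝ => G (ρ * Complex.exp (θ * Complex.I))) t
    rw [add_zero] at h2
    rw [← h2]
    congr 1 with θ
    rw [hc, ← Complex.exp_add, ← add_mul, Complex.ofReal_add]
  have hpi := Real.pi_pos
  rw [hrot fun z => ‖h z‖ ^ 2] at e1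
  rw [hrot fun z => ‖g z‖ ^ 2] at e2
  simp only [Pi.mul_apply] at e3
  rw [hrot fun z => ‖h z * g z‖] at e3
  have n1 := norm_sq_dilationLp hh.continuousOn h0.le h1 t
  have n2 := norm_sq_dilationLp hg.continuousOn h0.le h1 t
  have n3 := integral_norm_mul_dilationLp hh.continuousOn hg.continuousOn h0.le h1 t
  rw [eq_inv_mul_iff_mul_eq₀ (by positivity)] at n1 n2 n3
  rw [← n1] at e1
  rw [← n2] at e2
  rw [← n3] at e3
  have hmem : ∀ x ∈ Set.uIcc (-1 : ℝ) 1, (x : ℂ) ∈ Metric.ball (0 : ℂ) ρ⁻¹ := fun x hx => by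
    rw [Set.uIcc_of_le (by norm_num)] at hx
    simpa using (abs_le.2 hx).trans_lt hρ
  have cH : ContinuousOn (fun x : ℝ => h (ρ * (c * x))) (Set.uIcc (-1) 1) :=
    hHd.continuousOn.comp Complex.continuous_ofReal.continuousOn hmem
  have cG : ContinuousOn (fun x : ℝ => g (ρ * (c * x))) (Set.uIcc (-1) 1) :=
    hGd.continuousOn.comp Complex.continuous_ofReal.continuousOn hmem
  have i1 : IntervalIntegrable (fun x : ℝ => ‖h (ρ * (c * x))‖ ^ 2) volume (-1) 1 :=
    (cH.norm.pow 2).intervalIntegrable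
  have i2 : IntervalIntegrable (fun x : ℝ => ‖g (ρ * (c * x))‖ ^ 2) volume (-1) 1 :=
    (cG.norm.pow 2).intervalIntegrable
  have i3 : IntervalIntegrable (fun x : ℝ => ‖h (ρ * (c * x)) * g (ρ * (c * x))‖)
    volume (-1) 1 := (cH.mul cG).norm.intervalIntegrable
  have hscale : ∫ x in (-ρ)..ρ, ‖h (x * c) + (starRingEnd ℂ) (g (x * c))‖ ^ 2
      = ρ * ∫ x in (-1 : ℝ)..1,
        ‖h (ρ * (c * x)) + (starRingEnd ℂ) (g (ρ * (c * x)))‖ ^ 2 := by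
    have h2 := intervalIntegral.mul_integral_comp_mul_left (a := -1) (b := 1)
      (f := fun x : ℝ => ‖h (x * c) + (starRingEnd ℂ) (g (x * c))‖ ^ 2) (c := ρ)
    rw [mul_neg, mul_one] at h2
    rw [← h2]
    congr 2 with x
    rw [show ((ρ * x : ℝ) : ℂ) * c = ρ * (c * x) by push_cast; ring]
  rw [hscale]
  refine mul_le_mul_of_nonneg_left ?_ h0.le
  calc ∫ x in (-1 : ℝ)..1, ‖h (ρ * (c * x)) + (starRingEnd ℂ) (g (ρ * (c * x)))‖ ^ 2
      ≤ ∫ x in (-1 : ℝ)..1, (‖h (ρ * (c * x))‖ ^ 2 + ‖g (ρ * (c * x))‖ ^ 2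
          + 2 * ‖h (ρ * (c * x)) * g (ρ * (c * x))‖) := by
        refine intervalIntegral.integral_mono_on (by norm_num) ?_ ((i1.add i2).add (i3.const_mul 2))
          fun x _ => ?_
        · exact ((cH.add (Complex.continuous_conj.comp_continuousOn cG)).norm.pow
            2).intervalIntegrable
        · rw [norm_add_conj_sq]
          linarith [Complex.re_le_norm (h (ρ * (c * x)) * g (ρ * (c * x)))]
    _ = (∫ x in (-1 : ℝ)..1, ‖h (ρ * (c * x))‖ ^ 2) + (∫ x in (-1 : ℝ)..1, ‖g (ρ * (c * x))‖ ^ 2)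
          + 2 * ∫ x in (-1 : ℝ)..1, ‖h (ρ * (c * x)) * g (ρ * (c * x))‖ := by
        rw [intervalIntegral.integral_add (i1.add i2) (i3.const_mul 2),
          intervalIntegral.integral_add i1 i2, intervalIntegral.integral_const_mul]
    _ ≤ _ := by linarith

end Dilations

/-! ### Passage to the boundary for functions in the harmonic Hardy space. -/

section HardySpace

open AddCircle

variable {f h g : ℂ → ℂ}

/-- With the cross term gone, the left side is exactly the squared integral mean of `f`. A bound on
`f` thus controls `h` and `g` separately. -/
theorem IsCanonicalDecomposition.norm_sq_dilationLp_add_le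
    (hd : IsCanonicalDecomposition f h g) {M r : ℝ} (h0 : 0 ≤ r) (h1 : r < 1)
    (hM : integralMean 2 r f ≤ M) :
    ‖dilationLp h r‖ ^ 2 + ‖dilationLp g r‖ ^ 2 ≤ M ^ 2 := by
  have hpi := Real.pi_pos
  have h2 := integral_norm_add_conj_sq (dilationLp h r) (dilationLp g r)
  rw [integral_mul_dilationLp_eq_zero hd.analytic_h hd.analytic_g hd.normalized h0 h1,
    Complex.zero_re, mul_zero, add_zero] at h2
  rw [← h2, integral_congr_ae (g := fun θ => ‖f (r * (toCircle θ : ℂ))‖ ^ 2)]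
  · rw [integral_haarAddCircle_eq_intervalIntegral _ 0, zero_add, smul_eq_mul]
    simp only [coe_toCircle_two_pi]
    simp only [integralMean, Real.rpow_two, one_div] at hM
    set X := (2 * Real.pi)⁻¹ * ∫ θ in (0 : ℝ)..(2 * Real.pi),
      ‖f ((r : ℂ) * Complex.exp ((θ : ℂ) * Complex.I))‖ ^ 2 with hX
    have hX0 : 0 ≤ X := mul_nonneg (by positivity)
      (intervalIntegral.integral_nonneg (by positivity) fun θ _ => by positivity)
    have h3 : (X ^ (2 : ℝ)⁻¹) ^ 2 = X := by
      rw [← Real.rpow_two, ← Real.rpow_mul hX0]; norm_num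
    rw [← h3]
    exact pow_le_pow_left₀ (Real.rpow_nonneg hX0 _) hM 2
  · filter_upwards [coeFn_dilationLp hd.analytic_h.continuousOn h0 h1,
      coeFn_dilationLp hd.analytic_g.continuousOn h0 h1] with θ hθ hθ'
    rw [hθ, hθ', hd.eq_on_disk _ (by simpa using norm_mul_toCircle_lt h0 h1 θ)]

/-- The boundary functions of the analytic and the conjugate analytic part of `f`. -/
structure HasBoundaryFunctions (h g : ℂ → ℂ) (φ γ : CircleL2) : Prop where
  left : Tendsto (dilationLp h) (𝓝[<] 1) (𝓝 φ)
  right : Tendsto (dilationLp g) (𝓝[<] 1) (𝓝 γ)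

theorem MemHarmonicHardy.exists_hasBoundaryFunctions (hf : MemHarmonicHardy 2 f)
    (hd : IsCanonicalDecomposition f h g) : ∃ φ γ, HasBoundaryFunctions h g φ γ := by
  obtain ⟨M, hM⟩ := hf.bounded
  obtain ⟨φ, hφ⟩ := exists_tendsto_dilationLp hd.analytic_h (M := M ^ 2) fun r h0 h1 => by
    nlinarith [hd.norm_sq_dilationLp_add_le h0 h1 (hM r h0 h1), sq_nonneg ‖dilationLp g r‖]
  obtain ⟨γ, hγ⟩ := exists_tendsto_dilationLp hd.analytic_g (M := M ^ 2) fun r h0 h1 => by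
    nlinarith [hd.norm_sq_dilationLp_add_le h0 h1 (hM r h0 h1), sq_nonneg ‖dilationLp h r‖]
  exact ⟨φ, γ, hφ, hγ⟩

variable {φ γ : CircleL2}

theorem HasBoundaryFunctions.integral_mul_eq_zero (hb : HasBoundaryFunctions h g φ γ)
    (hd : IsCanonicalDecomposition f h g) : ∫ θ, φ θ * γ θ ∂haarAddCircle = 0 := by
  have h1 := (continuous_integral_mul_circleL2.tendsto (φ, γ)).comp
    (hb.left.prodMk_nhds hb.right)
  refine tendsto_nhds_unique h1 (tendsto_const_nhds.congr' ?_)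
  filter_upwards [Ioo_mem_nhdsLT (zero_lt_one' ℝ)] with r hr
  exact (integral_mul_dilationLp_eq_zero hd.analytic_h hd.analytic_g hd.normalized
    hr.1.le hr.2).symm

theorem HasBoundaryFunctions.ae_hasRadialLimit_mul (hb : HasBoundaryFunctions h g φ γ)
    (hd : IsCanonicalDecomposition f h g) :
    ∀ᵐ θ : ℝ, HasRadialLimit (fun z => h z * g z) θ (φ θ * γ θ) := by
  filter_upwards [ae_hasRadialLimit hd.analytic_h hb.left,
    ae_hasRadialLimit hd.analytic_g hb.right] with θ h1 h2
  exact Tendsto.mul h1 h2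

theorem HasBoundaryFunctions.ae_hasRadialLimit_add_conj (hb : HasBoundaryFunctions h g φ γ)
    (hd : IsCanonicalDecomposition f h g) :
    ∀ᵐ θ : ℝ, HasRadialLimit f θ (φ θ + (starRingEnd ℂ) (γ θ)) := by
  filter_upwards [ae_hasRadialLimit hd.analytic_h hb.left,
    ae_hasRadialLimit hd.analytic_g hb.right] with θ h1 h2
  refine (Tendsto.add h1 ((Complex.continuous_conj.tendsto _).comp h2)).congr' ?_
  filter_upwards [Ioo_mem_nhdsLT (zero_lt_one' ℝ)] with r hr
  refine (hd.eq_on_disk _ ?_).symm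
  rw [mem_ball_zero_iff, norm_mul, Complex.norm_exp_ofReal_mul_I, mul_one, Complex.norm_real,
    Real.norm_of_nonneg hr.1.le]
  exact hr.2

theorem HasRadialLimit.boundaryValue_eq {F : ℂ → ℂ} {θ : ℝ} {w : ℂ}
    (hF : HasRadialLimit F θ w) : boundaryValue F θ = w :=
  Tendsto.limUnder_eq hF

theorem intervalIntegrable_comp_coe_of_integrable {G : AddCircle (2 * Real.pi) → ℝ}
    (hG : Integrable G haarAddCircle) :
    IntervalIntegrable (fun x : ℝ => G x) volume 0 (2 * Real.pi) := by
  have hint : Integrable G volume := by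
    rw [volume_eq_smul_haarAddCircle]
    exact hG.smul_measure ENNReal.ofReal_ne_top
  rw [intervalIntegrable_iff_integrableOn_Ioc_of_le Real.two_pi_pos.le]
  have := (AddCircle.measurePreserving_mk (2 * Real.pi) 0).integrable_comp_of_integrable hint
  rwa [zero_add] at this

theorem HasBoundaryFunctions.ae_norm_boundaryValue_sq (hb : HasBoundaryFunctions h g φ γ)
    (hd : IsCanonicalDecomposition f h g) :
    ∀ᵐ θ : ℝ, ‖boundaryValue f θ‖ ^ 2 = ‖φ θ + (starRingEnd ℂ) (γ θ)‖ ^ 2 := by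
  filter_upwards [hb.ae_hasRadialLimit_add_conj hd] with θ hθ
  rw [hθ.boundaryValue_eq]

theorem HasBoundaryFunctions.ae_norm_boundaryValue_mul (hb : HasBoundaryFunctions h g φ γ)
    (hd : IsCanonicalDecomposition f h g) :
    ∀ᵐ θ : ℝ, ‖boundaryValue (fun z => h z * g z) θ‖ = ‖φ θ * γ θ‖ := by
  filter_upwards [hb.ae_hasRadialLimit_mul hd] with θ hθ
  rw [hθ.boundaryValue_eq]

theorem HasBoundaryFunctions.intervalIntegrable_norm_sq (hb : HasBoundaryFunctions h g φ γ)
    (hd : IsCanonicalDecomposition f h g) :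
    IntervalIntegrable (fun θ : ℝ => ‖boundaryValue f θ‖ ^ 2) volume 0 (2 * Real.pi) := by
  have hm : MemLp (fun θ => φ θ + (starRingEnd ℂ) (γ θ)) 2 haarAddCircle :=
    (Lp.memLp φ).add (Lp.memLp γ).star
  refine (intervalIntegrable_comp_coe_of_integrable
    (hm.integrable_norm_pow two_ne_zero)).congr_ae (ae_restrict_of_ae ?_)
  filter_upwards [hb.ae_norm_boundaryValue_sq hd] with θ hθ using hθ.symm

theorem HasBoundaryFunctions.intervalIntegrable_norm_mul (hb : HasBoundaryFunctions h g φ γ)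
    (hd : IsCanonicalDecomposition f h g) :
    IntervalIntegrable (fun θ : ℝ => ‖boundaryValue (fun z => h z * g z) θ‖)
      volume 0 (2 * Real.pi) := by
  refine (intervalIntegrable_comp_coe_of_integrable
    (integrable_mul_circleL2 φ γ).norm).congr_ae (ae_restrict_of_ae ?_)
  filter_upwards [hb.ae_norm_boundaryValue_mul hd] with θ hθ using hθ.symm

theorem HasBoundaryFunctions.boundarySqIntegral_eq (hb : HasBoundaryFunctions h g φ γ)
    (hd : IsCanonicalDecomposition f h g) :
    boundarySqIntegral f = 2 * Real.pi * (‖φ‖ ^ 2 + ‖γ‖ ^ 2) := by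
  have h2 := integral_norm_add_conj_sq φ γ
  rw [hb.integral_mul_eq_zero hd, Complex.zero_re, mul_zero, add_zero,
    integral_haarAddCircle_eq_intervalIntegral _ 0, zero_add, smul_eq_mul] at h2
  rw [← h2, mul_inv_cancel_left₀ Real.two_pi_pos.ne', boundarySqIntegral]
  refine intervalIntegral.integral_congr_ae ?_
  filter_upwards [hb.ae_norm_boundaryValue_sq hd] with θ hθ _ using hθ

theorem HasBoundaryFunctions.prodL1Norm_eq (hb : HasBoundaryFunctions h g φ γ)
    (hd : IsCanonicalDecomposition f h g) :
    prodL1Norm h g = 2 * Real.pi * ∫ θ, ‖φ θ * γ θ‖ ∂haarAddCircle := by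
  rw [integral_haarAddCircle_eq_intervalIntegral _ 0, zero_add, smul_eq_mul,
    mul_inv_cancel_left₀ Real.two_pi_pos.ne', prodL1Norm]
  refine intervalIntegral.integral_congr_ae ?_
  filter_upwards [hb.ae_norm_boundaryValue_mul hd] with θ hθ _ using hθ

/-- The diameter is exhausted by `[-ρ, ρ]` with `ρ → 1`. The bounds on these segments converge to
the asserted one, and their boundedness also yields integrability up to the endpoints. -/
theorem HasBoundaryFunctions.diameterIntegral_le (hb : HasBoundaryFunctions h g φ γ)
    (hd : IsCanonicalDecomposition f h g) (t : ℝ) :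
    IntervalIntegrable (fun x : ℝ => ‖f ((x : ℂ) * Complex.exp ((t : ℂ) * Complex.I))‖ ^ 2)
      volume (-1) 1 ∧
    diameterIntegral f t ≤ (1 / 2) * boundarySqIntegral f + prodL1Norm h g := by
  rw [hb.boundarySqIntegral_eq hd, hb.prodL1Norm_eq hd]
  set F : ℝ → ℝ := fun x => ‖f ((x : ℂ) * Complex.exp ((t : ℂ) * Complex.I))‖ ^ 2 with hF
  set R : ℝ → ℝ := fun ρ => ρ * (Real.pi * (‖dilationLp h ρ‖ ^ 2 + ‖dilationLp g ρ‖ ^ 2)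
        + 2 * Real.pi * ∫ θ, ‖dilationLp h ρ θ * dilationLp g ρ θ‖ ∂haarAddCircle) with hR
  obtain ⟨u, -, hu, hulim⟩ := exists_seq_strictMono_tendsto' (zero_lt_one' ℝ)
  have hulim' : Tendsto u atTop (𝓝[<] 1) :=
    tendsto_nhdsWithin_iff.2 ⟨hulim, Eventually.of_forall fun n => (hu n).2⟩
  have hmem : ∀ n, ∀ x ∈ Set.Icc (-u n) (u n),
      (x : ℂ) * Complex.exp ((t : ℂ) * Complex.I) ∈ Metric.ball (0 : ℂ) 1 := fun n x hx => by
    rw [mem_ball_zero_iff, norm_mul, Complex.norm_exp_ofReal_mul_I, mul_one, Complex.norm_real]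
    exact (abs_le.2 hx).trans_lt (hu n).2
  have hle : ∀ n, -u n ≤ u n := fun n => by linarith [(hu n).1]
  have hfc : ContinuousOn f (Metric.ball 0 1) :=
    (hd.analytic_h.continuousOn.add
      (Complex.continuous_conj.comp_continuousOn hd.analytic_g.continuousOn)).congr hd.eq_on_disk
  have hint : ∀ n, IntegrableOn F (Set.Ioc (-u n) (u n)) := fun n => by
    refine (ContinuousOn.integrableOn_Icc ?_).mono_set Set.Ioc_subset_Icc_self
    exact (hfc.comp (by fun_prop) (hmem n)).norm.pow 2
  have hbound : ∀ n, ∫ x in Set.Ioc (-u n) (u n), F x ≤ R (u n) := fun n => by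
    refine le_trans (le_of_eq ?_)
      (integral_norm_sq_add_conj_diameter_le hd.analytic_h hd.analytic_g (hu n).1 (hu n).2 t)
    rw [← intervalIntegral.integral_of_le (hle n)]
    refine intervalIntegral.integral_congr fun x hx => ?_
    rw [Set.uIcc_of_le (hle n)] at hx
    simp only [hF]
    rw [hd.eq_on_disk _ (hmem n x hx)]
  have hRlim : Tendsto (fun n => R (u n)) atTop
      (𝓝 (1 / 2 * (2 * Real.pi * (‖φ‖ ^ 2 + ‖γ‖ ^ 2))
        + 2 * Real.pi * ∫ θ, ‖φ θ * γ θ‖ ∂haarAddCircle)) := by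
    have h1 := (continuous_integral_norm_mul_circleL2.tendsto (φ, γ)).comp
      (hb.left.prodMk_nhds hb.right)
    have h2 := ((hb.left.norm.pow 2).add (hb.right.norm.pow 2)).const_mul Real.pi
    have h3 := (tendsto_id.mono_left (nhdsWithin_le_nhds (a := (1 : ℝ)) (s := Set.Iio 1))).mul
      (h2.add (h1.const_mul (2 * Real.pi)))
    have h4 := h3.comp hulim'
    convert! h4 using 2
    ring
  have hneg : Tendsto (fun n => -u n) atTop (𝓝 (-1)) := hulim.neg
  have hF0 : ∀ x, ‖F x‖ = F x := fun x => Real.norm_of_nonneg (by positivity)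
  obtain ⟨B, hB⟩ := hRlim.bddAbove_range
  have hintF : IntegrableOn F (Set.Ioc (-1) 1) := by
    refine integrableOn_Ioc_of_intervalIntegral_norm_bounded (I := B) hint hneg hulim
      (Eventually.of_forall fun n => ?_)
    simp only [hF0]
    exact (hbound n).trans (hB ⟨n, rfl⟩)
  refine ⟨(intervalIntegrable_iff_integrableOn_Ioc_of_le (by norm_num)).2 hintF, ?_⟩
  rw [diameterIntegral, intervalIntegral.integral_of_le (by norm_num)]
  have hcov := (aecover_Ioc_of_Ioc (μ := volume) hneg hulim).integral_tendsto_of_countably_generated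
    hintF
  refine le_of_tendsto_of_tendsto' hcov hRlim fun n => ?_
  rw [Measure.restrict_restrict measurableSet_Ioc, Set.inter_eq_left.2]
  · exact hbound n
  · exact Set.Ioc_subset_Ioc (by linarith [(hu n).2]) (hu n).2.le

theorem HasBoundaryFunctions.half_boundarySqIntegral_add_le
    (hb : HasBoundaryFunctions h g φ γ) (hd : IsCanonicalDecomposition f h g) :
    (1 / 2) * boundarySqIntegral f + prodL1Norm h g ≤ boundarySqIntegral f := by
  rw [hb.boundarySqIntegral_eq hd, hb.prodL1Norm_eq hd]
  have := mul_le_mul_of_nonneg_left (integral_norm_mul_le φ γ) Real.two_pi_pos.le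
  linarith

end HardySpace

end

noncomputable section

/-! ### Sharpness. -/

section Extremal

/-- The analytic part of the near-extremal function; `c` is a rotation and `1 < R`. -/
def extremalAnalytic (R : ℝ) (c z : ℂ) : ℂ := (((R : ℂ) - c * z) ^ ((2 : ℂ)⁻¹))⁻¹

/-- The conjugate of the co-analytic part of the near-extremal function. -/
def extremalCoanalytic (R : ℝ) (c z : ℂ) : ℂ := c * z * extremalAnalytic R c z

/-- The near-extremal harmonic function. -/
def extremalHarmonic (R : ℝ) (c z : ℂ) : ℂ :=
  extremalAnalytic R c z + (starRingEnd ℂ) (extremalCoanalytic R c z)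

variable {R : ℝ} {c : ℂ}

theorem extremalAnalytic_sq (R : ℝ) (c z : ℂ) :
    extremalAnalytic R c z ^ 2 = ((R : ℂ) - c * z)⁻¹ := by
  rw [extremalAnalytic, inv_pow, sq_cpow_half]

theorem norm_extremalAnalytic_sq (R : ℝ) (c z : ℂ) :
    ‖extremalAnalytic R c z‖ ^ 2 = ‖(R : ℂ) - c * z‖⁻¹ := by
  rw [← norm_pow, extremalAnalytic_sq, norm_inv]

theorem differentiableAt_extremalAnalytic (hc : ‖c‖ = 1) {z : ℂ} (hz : ‖z‖ < R) :
    DifferentiableAt ℂ (extremalAnalytic R c) z := by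
  have hs : (R : ℂ) - c * z ∈ Complex.slitPlane := Or.inl (by
    have h1 : (c * z).re ≤ ‖z‖ := by
      simpa [hc] using Complex.re_le_norm (c * z)
    rw [Complex.sub_re, Complex.ofReal_re]
    linarith)
  have h0 : (R : ℂ) - c * z ≠ 0 := Complex.slitPlane_ne_zero hs
  refine DifferentiableAt.inv (DifferentiableAt.cpow_const
    ((differentiableAt_const _).sub (differentiableAt_id.const_mul c)) hs) ?_
  rw [Complex.cpow_ne_zero_iff]
  exact Or.inl h0

theorem differentiableAt_extremalCoanalytic (hc : ‖c‖ = 1) {z : ℂ} (hz : ‖z‖ < R) :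
    DifferentiableAt ℂ (extremalCoanalytic R c) z :=
  (differentiableAt_id.const_mul c).mul (differentiableAt_extremalAnalytic hc hz)

theorem continuousAt_extremalHarmonic (hc : ‖c‖ = 1) {z : ℂ} (hz : ‖z‖ < R) :
    ContinuousAt (extremalHarmonic R c) z :=
  (differentiableAt_extremalAnalytic hc hz).continuousAt.add
    (Complex.continuous_conj.continuousAt.comp
      (differentiableAt_extremalCoanalytic hc hz).continuousAt)

theorem isCanonicalDecomposition_extremal (hR : 1 < R) (hc : ‖c‖ = 1) :
    IsCanonicalDecomposition (extremalHarmonic R c) (extremalAnalytic R c)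
      (extremalCoanalytic R c) where
  analytic_h z hz := (differentiableAt_extremalAnalytic hc
    ((mem_ball_zero_iff.1 hz).trans hR)).differentiableWithinAt
  analytic_g z hz := (differentiableAt_extremalCoanalytic hc
    ((mem_ball_zero_iff.1 hz).trans hR)).differentiableWithinAt
  normalized := by simp [extremalCoanalytic]
  eq_on_disk _ _ := rfl

theorem IsCanonicalDecomposition.harmonicOnNhd {f h g : ℂ → ℂ}
    (hd : IsCanonicalDecomposition f h g) :
    InnerProductSpace.HarmonicOnNhd f (Metric.ball (0 : ℂ) 1) := by
  intro z hz
  have h1 := (hd.analytic_h.analyticAt (Metric.isOpen_ball.mem_nhds hz)).harmonicAt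
  have h2 := (hd.analytic_g.analyticAt (Metric.isOpen_ball.mem_nhds hz)).harmonicAt_conj
  refine (InnerProductSpace.harmonicAt_congr_nhds ?_).2 (h1.add h2)
  filter_upwards [Metric.isOpen_ball.mem_nhds hz] with w hw
  exact hd.eq_on_disk w hw

theorem integralMean_two_le {f : ℂ → ℂ} {r K : ℝ} (hK : 0 ≤ K)
    (hf : ∀ θ : ℝ, ‖f ((r : ℂ) * Complex.exp ((θ : ℂ) * Complex.I))‖ ≤ K) :
    integralMean 2 r f ≤ K := by
  have hpi := Real.pi_pos
  have h1 : ∫ θ in (0 : ℝ)..(2 * Real.pi),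
      ‖f ((r : ℂ) * Complex.exp ((θ : ℂ) * Complex.I))‖ ^ (2 : ℝ) ≤ K ^ 2 * (2 * Real.pi) := by
    refine (le_abs_self _).trans ?_
    rw [← Real.norm_eq_abs]
    refine (intervalIntegral.norm_integral_le_of_norm_le_const (C := K ^ 2) fun θ _ => ?_).trans ?_
    · rw [Real.rpow_two, norm_pow, norm_norm]
      exact pow_le_pow_left₀ (norm_nonneg _) (hf θ) 2
    · rw [sub_zero, abs_of_pos (by positivity)]
  have h0 : 0 ≤ ∫ θ in (0 : ℝ)..(2 * Real.pi),
      ‖f ((r : ℂ) * Complex.exp ((θ : ℂ) * Complex.I))‖ ^ (2 : ℝ) :=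
    intervalIntegral.integral_nonneg (by positivity) fun θ _ => by positivity
  have h2 : 1 / (2 * Real.pi) * ∫ θ in (0 : ℝ)..(2 * Real.pi),
      ‖f ((r : ℂ) * Complex.exp ((θ : ℂ) * Complex.I))‖ ^ (2 : ℝ) ≤ K ^ (2 : ℝ) := by
    rw [Real.rpow_two, one_div, inv_mul_le_iff₀ (by positivity)]
    linarith
  rw [integralMean]
  calc _ ≤ (K ^ (2 : ℝ)) ^ (1 / (2 : ℝ)) :=
        Real.rpow_le_rpow (by positivity) h2 (by norm_num)
    _ = K := by rw [← Real.rpow_mul hK]; norm_num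

theorem memHarmonicHardy_extremal (hR : 1 < R) (hc : ‖c‖ = 1) :
    MemHarmonicHardy 2 (extremalHarmonic R c) where
  harmonic := (isCanonicalDecomposition_extremal hR hc).harmonicOnNhd
  bounded := by
    have hcont : ContinuousOn (extremalHarmonic R c) (Metric.closedBall 0 1) := fun z hz =>
      (continuousAt_extremalHarmonic hc
        ((mem_closedBall_zero_iff.1 hz).trans_lt hR)).continuousWithinAt
    obtain ⟨K, hK⟩ := (isCompact_closedBall (0 : ℂ) 1).exists_bound_of_continuousOn hcont
    refine ⟨K, fun r h0 h1 => integralMean_two_le ((norm_nonneg _).trans (hK 0 (by simp)))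
      fun θ => hK _ ?_⟩
    rw [mem_closedBall_zero_iff, norm_mul, Complex.norm_exp_ofReal_mul_I, mul_one,
      Complex.norm_real, Real.norm_of_nonneg h0]
    exact h1.le

theorem ContinuousAt.boundaryValue_eq {F : ℂ → ℂ} {θ : ℝ}
    (hF : ContinuousAt F (Complex.exp (θ * Complex.I))) :
    boundaryValue F θ = F (Complex.exp (θ * Complex.I)) := by
  refine HasRadialLimit.boundaryValue_eq (hF.tendsto.comp ?_)
  have : Continuous fun r : ℝ => (r : ℂ) * Complex.exp (θ * Complex.I) := by fun_prop
  simpa using (this.tendsto 1).mono_left nhdsWithin_le_nhds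

theorem continuous_norm_sub_inv (hR : 1 < R) (hc : ‖c‖ = 1) :
    Continuous fun θ : ℝ => ‖(R : ℂ) - c * Complex.exp (θ * Complex.I)‖⁻¹ := by
  refine Continuous.inv₀ (by fun_prop) fun θ h0 => ?_
  have h1 : (R : ℂ) = c * Complex.exp (θ * Complex.I) := sub_eq_zero.1 (norm_eq_zero.1 h0)
  have h2 := congrArg norm h1
  rw [norm_mul, hc, Complex.norm_exp_ofReal_mul_I, Complex.norm_real,
    Real.norm_of_nonneg (by linarith)] at h2
  linarith

theorem continuous_norm_sub_exp_inv (hR : 1 < R) :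
    Continuous fun θ : ℝ => ‖(R : ℂ) - Complex.exp (θ * Complex.I)‖⁻¹ := by
  simpa only [one_mul] using continuous_norm_sub_inv (c := 1) hR norm_one

theorem prodL1Norm_extremal (hR : 1 < R) (hc : ‖c‖ = 1) :
    prodL1Norm (extremalAnalytic R c) (extremalCoanalytic R c)
      = ∫ θ in (0 : ℝ)..(2 * Real.pi), ‖(R : ℂ) - c * Complex.exp (θ * Complex.I)‖⁻¹ := by
  rw [prodL1Norm]
  congr 1 with θ
  have hz : ‖Complex.exp (θ * Complex.I)‖ < R := by rwa [Complex.norm_exp_ofReal_mul_I]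
  rw [ContinuousAt.boundaryValue_eq (F := fun z => extremalAnalytic R c z
      * extremalCoanalytic R c z) ((differentiableAt_extremalAnalytic hc hz).continuousAt.mul
    (differentiableAt_extremalCoanalytic hc hz).continuousAt), ← norm_extremalAnalytic_sq,
    extremalCoanalytic, norm_mul, norm_mul, norm_mul, hc, Complex.norm_exp_ofReal_mul_I]
  ring

/-- On the circle both parts have the same modulus, and the cross term has mean zero because the
second part vanishes at the origin. -/
theorem boundarySqIntegral_extremal (hR : 1 < R) (hc : ‖c‖ = 1) :
    boundarySqIntegral (extremalHarmonic R c)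
      = 2 * ∫ θ in (0 : ℝ)..(2 * Real.pi), ‖(R : ℂ) - c * Complex.exp (θ * Complex.I)‖⁻¹ := by
  have hz : ∀ θ : ℝ, ‖Complex.exp (θ * Complex.I)‖ < R := fun θ => by
    rwa [Complex.norm_exp_ofReal_mul_I]
  set P : ℝ → ℂ := fun θ => extremalAnalytic R c (Complex.exp (θ * Complex.I))
    * extremalCoanalytic R c (Complex.exp (θ * Complex.I)) with hP
  have hPc : Continuous P := continuous_iff_continuousAt.2 fun θ => by
    have he : ContinuousAt (fun θ : ℝ => Complex.exp (θ * Complex.I)) θ := by fun_prop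
    exact (ContinuousAt.comp (f := fun θ : ℝ => Complex.exp (θ * Complex.I))
      (differentiableAt_extremalAnalytic hc (hz θ)).continuousAt he).mul
      (ContinuousAt.comp (f := fun θ : ℝ => Complex.exp (θ * Complex.I))
      (differentiableAt_extremalCoanalytic hc (hz θ)).continuousAt he)
  have hmean : ∫ θ in (0 : ℝ)..(2 * Real.pi), P θ = 0 := by
    have hd : DiffContOnCl ℂ (fun z => extremalAnalytic R c z * extremalCoanalytic R c z)
        (Metric.ball 0 |1|) := by
      refine DifferentiableOn.diffContOnCl fun z hz => ?_
      have hz' : ‖z‖ < R := by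
        have := Metric.closure_ball_subset_closedBall hz
        rw [mem_closedBall_zero_iff, abs_one] at this
        linarith
      exact ((differentiableAt_extremalAnalytic hc hz').mul
        (differentiableAt_extremalCoanalytic hc hz')).differentiableWithinAt
    have h := hd.circleAverage
    simp only [Real.circleAverage_def, circleMap_zero, Complex.ofReal_one, one_mul] at h
    rw [show extremalCoanalytic R c 0 = 0 by simp [extremalCoanalytic], mul_zero] at h
    exact (smul_eq_zero.1 h).resolve_left (inv_ne_zero Real.two_pi_pos.ne')
  have hpoint : ∀ θ : ℝ, ‖boundaryValue (extremalHarmonic R c) θ‖ ^ 2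
      = 2 * ‖(R : ℂ) - c * Complex.exp (θ * Complex.I)‖⁻¹ + 2 * (P θ).re := fun θ => by
    rw [ContinuousAt.boundaryValue_eq (continuousAt_extremalHarmonic hc (hz θ)), extremalHarmonic,
      norm_add_conj_sq, ← norm_extremalAnalytic_sq]
    have : ‖extremalCoanalytic R c (Complex.exp (θ * Complex.I))‖
        = ‖extremalAnalytic R c (Complex.exp (θ * Complex.I))‖ := by
      rw [extremalCoanalytic, norm_mul, norm_mul, hc, Complex.norm_exp_ofReal_mul_I]
      ring
    rw [this, hP]
    ring
  have hre : ∫ θ in (0 : ℝ)..(2 * Real.pi), (P θ).re = 0 := by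
    have h := Complex.reCLM.intervalIntegral_comp_comm (hPc.intervalIntegrable (μ := volume) 0 (2 * Real.pi))
    rw [hmean, map_zero] at h
    exact h
  rw [boundarySqIntegral]
  simp only [hpoint]
  have hPre : Continuous fun θ => 2 * (P θ).re := (Complex.continuous_re.comp hPc).const_mul 2
  rw [intervalIntegral.integral_add
    (((continuous_norm_sub_inv hR hc).const_mul 2).intervalIntegrable _ _)
    (hPre.intervalIntegrable _ _), intervalIntegral.integral_const_mul,
    intervalIntegral.integral_const_mul, hre, mul_zero, add_zero]

theorem diameterIntegral_extremal (hR : 1 < R) (t : ℝ) :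
    diameterIntegral (extremalHarmonic R (Complex.exp ((-t : ℝ) * Complex.I))) t
      = ∫ x in (-1 : ℝ)..1, (1 + x) ^ 2 / (R - x) := by
  rw [diameterIntegral]
  refine intervalIntegral.integral_congr fun x hx => ?_
  rw [Set.uIcc_of_le (by norm_num)] at hx
  have hpos : 0 < R - x := by linarith [hx.2]
  set c : ℂ := Complex.exp ((-t : ℝ) * Complex.I) with hc
  -- The rotation is chosen so that the singularity faces the endpoint `x = 1` of the given
  -- diameter.
  have hcx : c * ((x : ℂ) * Complex.exp (t * Complex.I)) = x := by
    rw [mul_left_comm, hc, ← Complex.exp_add]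
    simp
  have hn : ‖extremalAnalytic R c ((x : ℂ) * Complex.exp (t * Complex.I))‖ ^ 2
      = (R - x)⁻¹ := by
    rw [norm_extremalAnalytic_sq, hcx, ← Complex.ofReal_sub, Complex.norm_real,
      Real.norm_of_nonneg hpos.le]
  have hp : extremalAnalytic R c ((x : ℂ) * Complex.exp (t * Complex.I))
      * (x * extremalAnalytic R c ((x : ℂ) * Complex.exp (t * Complex.I)))
      = ((x * (R - x)⁻¹ : ℝ) : ℂ) := by
    rw [mul_left_comm, ← sq, extremalAnalytic_sq, hcx]
    push_cast
    ring
  simp only [extremalHarmonic, extremalCoanalytic]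
  rw [norm_add_conj_sq, hcx, hp, norm_mul, mul_pow, hn, Complex.ofReal_re, Complex.norm_real,
    Real.norm_eq_abs, sq_abs]
  field_simp
  ring

theorem integral_norm_sub_inv_rotate (hR : 1 < R) (t : ℝ) :
    ∫ θ in (0 : ℝ)..(2 * Real.pi),
        ‖(R : ℂ) - Complex.exp ((t : ℝ) * Complex.I) * Complex.exp (θ * Complex.I)‖⁻¹
      = 2 * ∫ θ in (0 : ℝ)..Real.pi, ‖(R : ℂ) - Complex.exp (θ * Complex.I)‖⁻¹ := by
  set G : ℝ → ℝ := fun θ => ‖(R : ℂ) - Complex.exp (θ * Complex.I)‖⁻¹ with hG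
  have hGc : Continuous G := continuous_norm_sub_exp_inv hR
  have hper : Function.Periodic G (2 * Real.pi) := fun θ => by
    simp only [hG]
    push_cast
    rw [add_mul, Complex.exp_add, Complex.exp_two_pi_mul_I, mul_one]
  have hneg : ∀ θ, G (-θ) = G θ := fun θ => by
    have hconj : (R : ℂ) - Complex.exp ((-θ : ℝ) * Complex.I)
        = (starRingEnd ℂ) ((R : ℂ) - Complex.exp (θ * Complex.I)) := by
      rw [map_sub, Complex.conj_ofReal, ← Complex.exp_conj]
      simp
    simp only [hG]
    rw [hconj, RCLike.norm_conj]
  have hshift : ∫ θ in (0 : ℝ)..(2 * Real.pi),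
      ‖(R : ℂ) - Complex.exp ((t : ℝ) * Complex.I) * Complex.exp (θ * Complex.I)‖⁻¹
      = ∫ θ in t..(t + 2 * Real.pi), G θ := by
    have h := intervalIntegral.integral_comp_add_left (a := 0) (b := 2 * Real.pi) G t
    rw [add_zero] at h
    rw [← h]
    congr 1 with θ
    simp only [hG]
    rw [Complex.ofReal_add, add_mul, Complex.exp_add]
  have hhalf : ∫ θ in (-Real.pi)..0, G θ = ∫ θ in (0 : ℝ)..Real.pi, G θ := by
    have h := intervalIntegral.integral_comp_neg (a := 0) (b := Real.pi) G
    simp only [hneg, neg_zero] at h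
    exact h.symm
  have h := hper.intervalIntegral_add_eq t (-Real.pi)
  rw [show -Real.pi + 2 * Real.pi = Real.pi by ring] at h
  rw [hshift, h, ← intervalIntegral.integral_add_adjacent_intervals
    (hGc.intervalIntegrable (-Real.pi) 0) (hGc.intervalIntegrable 0 Real.pi), hhalf]
  ring

/-- The distance from `1 + δ` to `e^{iθ}` is at least `δ` and at least `2 sin(θ/2)`. The first bound
contributes `1` on `[0, δ]`; on `[δ, π]` the second integrates to `-log tan(δ/4)`, and `tan(δ/4) >
δ/4`. -/
theorem integral_norm_sub_exp_inv_le {δ : ℝ} (hδ : 0 < δ) (hδ1 : δ ≤ 1) :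
    ∫ θ in (0 : ℝ)..Real.pi, ‖((1 + δ : ℝ) : ℂ) - Complex.exp (θ * Complex.I)‖⁻¹
      ≤ -Real.log δ + (1 + Real.log 4) := by
  have hpi := Real.pi_gt_three
  set J : ℝ → ℝ := fun θ => ‖((1 + δ : ℝ) : ℂ) - Complex.exp (θ * Complex.I)‖⁻¹ with hJ
  have hJc : Continuous J := continuous_norm_sub_exp_inv (by linarith)
  have hnorm : ∀ θ : ℝ, ‖((1 + δ : ℝ) : ℂ) - Complex.exp (θ * Complex.I)‖ ^ 2
      = δ ^ 2 + (1 + δ) * (2 * Real.sin (θ / 2)) ^ 2 := fun θ => by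
    rw [← Complex.normSq_eq_norm_sq, Complex.normSq_apply]
    simp only [Complex.sub_re, Complex.sub_im, Complex.exp_ofReal_mul_I_re,
      Complex.exp_ofReal_mul_I_im, Complex.ofReal_re, Complex.ofReal_im]
    have h1 : Real.cos θ = 1 - 2 * Real.sin (θ / 2) ^ 2 := by
      have := Real.cos_two_mul (θ / 2)
      rw [mul_div_cancel₀ θ two_ne_zero] at this
      rw [this, Real.cos_sq']
      ring
    have h2 : Real.sin θ ^ 2 = 1 - Real.cos θ ^ 2 := Real.sin_sq θ
    nlinarith
  have hJ1 : ∀ θ, J θ ≤ δ⁻¹ := fun θ => by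
    refine inv_anti₀ hδ (le_of_sq_le_sq ?_ (norm_nonneg _))
    rw [hnorm]
    nlinarith [sq_nonneg (2 * Real.sin (θ / 2))]
  have hsinpos : ∀ θ ∈ Set.Icc δ Real.pi, 0 < Real.sin (θ / 2) := fun θ hθ =>
    Real.sin_pos_of_pos_of_lt_pi (by linarith [hθ.1]) (by linarith [hθ.2])
  have hJ2 : ∀ θ ∈ Set.Icc δ Real.pi, J θ ≤ (2 * Real.sin (θ / 2))⁻¹ := fun θ hθ => by
    have hs := hsinpos θ hθ
    refine inv_anti₀ (by positivity) (le_of_sq_le_sq ?_ (norm_nonneg _))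
    rw [hnorm]
    nlinarith [sq_nonneg (2 * Real.sin (θ / 2)), sq_nonneg δ]
  have hcontS : ContinuousOn (fun θ => (2 * Real.sin (θ / 2))⁻¹) (Set.uIcc δ Real.pi) := by
    rw [Set.uIcc_of_le (by linarith)]
    refine ContinuousOn.inv₀ (by fun_prop) fun θ hθ => ?_
    have := hsinpos θ hθ
    positivity
  have hI1 : ∫ θ in (0 : ℝ)..δ, J θ ≤ 1 := by
    calc ∫ θ in (0 : ℝ)..δ, J θ ≤ ∫ _ in (0 : ℝ)..δ, δ⁻¹ :=
          intervalIntegral.integral_mono_on hδ.le (hJc.intervalIntegrable _ _) (by simp)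
            fun θ _ => hJ1 θ
      _ = 1 := by simp [hδ.ne']
  have hprim : ∫ θ in δ..Real.pi, (2 * Real.sin (θ / 2))⁻¹
      = Real.log (Real.tan (Real.pi / 4)) - Real.log (Real.tan (δ / 4)) := by
    refine intervalIntegral.integral_eq_sub_of_hasDerivAt
      (f := fun θ => Real.log (Real.tan (θ / 4))) (fun θ hθ => ?_) hcontS.intervalIntegrable
    rw [Set.uIcc_of_le (by linarith)] at hθ
    have hs : 0 < Real.sin (θ / 4) :=
      Real.sin_pos_of_pos_of_lt_pi (by linarith [hθ.1]) (by linarith [hθ.2])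
    have hcs : 0 < Real.cos (θ / 4) :=
      Real.cos_pos_of_mem_Ioo ⟨by linarith [hθ.1], by linarith [hθ.2]⟩
    have ht : Real.tan (θ / 4) ≠ 0 := by
      rw [Real.tan_eq_sin_div_cos]
      positivity
    have h0 : HasDerivAt (fun θ => Real.tan (θ / 4)) (1 / Real.cos (θ / 4) ^ 2 * (1 / 4)) θ :=
      HasDerivAt.comp (h := fun θ : ℝ => θ / 4) θ (Real.hasDerivAt_tan hcs.ne')
        ((hasDerivAt_id θ).div_const 4)
    convert! h0.log ht using 1
    rw [show θ / 2 = 2 * (θ / 4) by ring, Real.sin_two_mul]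
    rw [Real.tan_eq_sin_div_cos]
    field_simp
    ring
  have hI2 : ∫ θ in δ..Real.pi, J θ ≤ -Real.log δ + Real.log 4 := by
    have htan : δ / 4 < Real.tan (δ / 4) := Real.lt_tan (by linarith) (by linarith)
    have hlog : Real.log (δ / 4) ≤ Real.log (Real.tan (δ / 4)) :=
      Real.log_le_log (by linarith) htan.le
    rw [Real.log_div hδ.ne' (by norm_num)] at hlog
    calc ∫ θ in δ..Real.pi, J θ ≤ ∫ θ in δ..Real.pi, (2 * Real.sin (θ / 2))⁻¹ :=
          intervalIntegral.integral_mono_on (by linarith) (hJc.intervalIntegrable _ _)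
            hcontS.intervalIntegrable hJ2
      _ ≤ _ := by
        rw [hprim, Real.tan_pi_div_four, Real.log_one]
        linarith
  rw [← intervalIntegral.integral_add_adjacent_intervals (hJc.intervalIntegrable 0 δ)
    (hJc.intervalIntegrable δ Real.pi)]
  linarith

/-- Only the pole matters: `(1 + x)² - 4 + 4(1 + δ - x) = (1 - x)² + 4δ ≥ 0`, so the integrand is at
least `4/(1 + δ - x) - 4`. -/
theorem le_integral_sq_div_sub {δ : ℝ} (hδ : 0 < δ) :
    -4 * Real.log δ - 8 ≤ ∫ x in (-1 : ℝ)..1, (1 + x) ^ 2 / (1 + δ - x) := by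
  have hpos : ∀ x ∈ Set.Icc (-1 : ℝ) 1, 0 < 1 + δ - x := fun x hx => by linarith [hx.2]
  have hle : (-1 : ℝ) ≤ 1 := by norm_num
  have hc1 : ContinuousOn (fun x : ℝ => 4 / (1 + δ - x) - 4) (Set.uIcc (-1) 1) := by
    rw [Set.uIcc_of_le hle]
    exact (ContinuousOn.div (by fun_prop) (by fun_prop) fun x hx => (hpos x hx).ne').sub
      continuousOn_const
  have hc2 : ContinuousOn (fun x : ℝ => (1 + x) ^ 2 / (1 + δ - x)) (Set.uIcc (-1) 1) := by
    rw [Set.uIcc_of_le hle]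
    exact ContinuousOn.div (by fun_prop) (by fun_prop) fun x hx => (hpos x hx).ne'
  have hprim : ∫ x in (-1 : ℝ)..1, (4 / (1 + δ - x) - 4)
      = (-4 * Real.log (1 + δ - 1) - 4 * 1) - (-4 * Real.log (1 + δ - -1) - 4 * (-1)) := by
    refine intervalIntegral.integral_eq_sub_of_hasDerivAt
      (f := fun x => -4 * Real.log (1 + δ - x) - 4 * x) (fun x hx => ?_) hc1.intervalIntegrable
    rw [Set.uIcc_of_le hle] at hx
    have h1 := ((((hasDerivAt_id x).const_sub (1 + δ)).log (hpos x hx).ne').const_mul (-4)).sub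
      ((hasDerivAt_id x).const_mul 4)
    convert! h1 using 1
    simp only [id_eq]
    ring
  have hlog : 0 ≤ Real.log (1 + δ - -1) := Real.log_nonneg (by linarith)
  calc -4 * Real.log δ - 8 ≤ ∫ x in (-1 : ℝ)..1, (4 / (1 + δ - x) - 4) := by
        rw [hprim, show 1 + δ - 1 = δ by ring]
        linarith
    _ ≤ _ := by
        refine intervalIntegral.integral_mono_on hle hc1.intervalIntegrable hc2.intervalIntegrable
          fun x hx => ?_
        have hp := hpos x hx
        rw [sub_le_iff_le_add, div_add' _ _ _ hp.ne']
        refine div_le_div_of_nonneg_right ?_ hp.le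
        nlinarith [hx.1, hx.2]

theorem exists_near_extremal (t C : ℝ) (hC : C < 1) :
    ∃ f h g : ℂ → ℂ, MemHarmonicHardy 2 f ∧ IsCanonicalDecomposition f h g ∧
      C * ((1 / 2) * boundarySqIntegral f + prodL1Norm h g) < diameterIntegral f t ∧
      C * boundarySqIntegral f < (1 / 2) * boundarySqIntegral f + prodL1Norm h g := by
  -- Nonnegativity is needed to multiply the upper bound for the integral `J` below; a negative `C`
  -- is absorbed here.
  set D : ℝ := max C 0 with hD
  have hD0 : 0 ≤ D := le_max_right _ _
  have hD1 : 0 < 1 - D := sub_pos.2 (max_lt hC zero_lt_one)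
  have hlog4 : 0 ≤ Real.log 4 := Real.log_nonneg (by norm_num)
  -- With `δ = e^{-L}` the first claim follows from `D (4L + 4(1 + log 4)) < 4L - 8`. As `D ≤ 1`, it
  -- suffices that `(1 + log 4) + 2 < L (1 - D)`.
  set A : ℝ := 3 + Real.log 4 with hA
  set L : ℝ := A / (1 - D) + 1 with hL
  have hL0 : 0 ≤ L := by positivity
  have hLA : A < L * (1 - D) := by
    rw [hL, add_mul, div_mul_cancel₀ _ hD1.ne']
    linarith
  set δ : ℝ := Real.exp (-L) with hδ
  have hδ0 : 0 < δ := Real.exp_pos _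
  have hδ1 : δ ≤ 1 := Real.exp_le_one_iff.2 (by linarith)
  have hlogδ : Real.log δ = -L := Real.log_exp _
  have hR : 1 < 1 + δ := by linarith
  set c : ℂ := Complex.exp ((-t : ℝ) * Complex.I) with hc
  have hcn : ‖c‖ = 1 := Complex.norm_exp_ofReal_mul_I _
  refine ⟨extremalHarmonic (1 + δ) c, extremalAnalytic (1 + δ) c, extremalCoanalytic (1 + δ) c,
    memHarmonicHardy_extremal hR hcn, isCanonicalDecomposition_extremal hR hcn, ?_⟩
  rw [boundarySqIntegral_extremal hR hcn, prodL1Norm_extremal hR hcn,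
    diameterIntegral_extremal hR t]
  have h1 := integral_norm_sub_inv_rotate hR (-t)
  rw [h1]
  have h2 := integral_norm_sub_exp_inv_le hδ0 hδ1
  have h3 := le_integral_sq_div_sub hδ0
  have h4 : 0 < ∫ θ in (0 : ℝ)..Real.pi,
      ‖((1 + δ : ℝ) : ℂ) - Complex.exp (θ * Complex.I)‖⁻¹ := by
    refine intervalIntegral.intervalIntegral_pos_of_pos
      ((continuous_norm_sub_exp_inv hR).intervalIntegrable _ _) (fun θ => ?_) Real.pi_pos
    refine inv_pos.2 (norm_pos_iff.2 fun h0 => ?_)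
    have h5 := congrArg norm (sub_eq_zero.1 h0)
    rw [Complex.norm_exp_ofReal_mul_I, Complex.norm_real, Real.norm_of_nonneg (by linarith)] at h5
    linarith
  rw [hlogδ] at h2 h3
  set J : ℝ := ∫ θ in (0 : ℝ)..Real.pi, ‖((1 + δ : ℝ) : ℂ) - Complex.exp (θ * Complex.I)‖⁻¹
  have hCD : C ≤ D := le_max_left _ _
  constructor
  · refine lt_of_lt_of_le ?_ h3
    have h5 : C * J ≤ D * J := mul_le_mul_of_nonneg_right hCD h4.le
    have h6 : D * J ≤ D * (L + (1 + Real.log 4)) := mul_le_mul_of_nonneg_left (by linarith) hD0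
    have h7 : D * (1 + Real.log 4) ≤ 1 + Real.log 4 :=
      mul_le_of_le_one_left (by linarith) (by linarith)
    nlinarith
  -- Here both the middle term and the full boundary integral equal `4J`, so this is `C < 1` with `J
  -- > 0`.
  · nlinarith

end Extremal

end

theorem theorem3 :
    (∀ f h g : ℂ → ℂ, MemHarmonicHardy 2 f → IsCanonicalDecomposition f h g →
      (∀ᵐ θ : ℝ, ∃ w : ℂ, HasRadialLimit f θ w) ∧
      (∀ᵐ θ : ℝ, ∃ w : ℂ, HasRadialLimit (fun z => h z * g z) θ w) ∧
      IntervalIntegrable (fun θ : ℝ => ‖boundaryValue f θ‖ ^ 2) volume 0 (2 * Real.pi) ∧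
      IntervalIntegrable (fun θ : ℝ => ‖boundaryValue (fun z => h z * g z) θ‖)
        volume 0 (2 * Real.pi) ∧
      ∀ t : ℝ,
        IntervalIntegrable
          (fun x : ℝ => ‖f ((x : ℂ) * Complex.exp ((t : ℂ) * Complex.I))‖ ^ 2) volume (-1) 1 ∧
        diameterIntegral f t ≤ (1 / 2) * boundarySqIntegral f + prodL1Norm h g ∧
        (1 / 2) * boundarySqIntegral f + prodL1Norm h g ≤ boundarySqIntegral f) ∧
    (∀ t C : ℝ, C < 1 →
      ∃ f h g : ℂ → ℂ, MemHarmonicHardy 2 f ∧ IsCanonicalDecomposition f h g ∧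
        C * ((1 / 2) * boundarySqIntegral f + prodL1Norm h g) < diameterIntegral f t ∧
        C * boundarySqIntegral f < (1 / 2) * boundarySqIntegral f + prodL1Norm h g) := by
  refine ⟨fun f h g hf hd => ?_, exists_near_extremal⟩
  obtain ⟨φ, γ, hb⟩ := hf.exists_hasBoundaryFunctions hd
  refine ⟨?_, ?_, hb.intervalIntegrable_norm_sq hd, hb.intervalIntegrable_norm_mul hd,
    fun t => ⟨(hb.diameterIntegral_le hd t).1, (hb.diameterIntegral_le hd t).2,
      hb.half_boundarySqIntegral_add_le hd⟩⟩
  · filter_upwards [hb.ae_hasRadialLimit_add_conj hd] with θ hθ using ⟨_, hθ⟩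
  · filter_upwards [hb.ae_hasRadialLimit_mul hd] with θ hθ using ⟨_, hθ⟩
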